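/- Let $b\ge 3$ and let $S_{b+1}$ be the sphere with $b+1$ holes, carrying a complete hyperbolic structure without cusps, with standard generators $g_1,\dots,g_{b+1}$ of $\pi_1(S_{b+1})$ corresponding to the boundary components, $g_1g_2\cdots g_{b+1}=1$, and holonomy $\rho:\pi_1(S_{b+1})\to \mathrm{PSL}(2,\mathbb R)\cong SO^0(2,1)$; the surface lies to the right of each boundary geodesic $g_i$. For $1\le j\le b-2$ let $h_j=g_{j+1}^{-1}g_j^{-1}\cdots g_1^{-1}$ be the dividing curves of the pants decomposition with pairs of pants $P_1=\langle g_1,g_2,h_1\rangle$, $P_j=\langle h_{j-1},g_{j+1},h_j\rangle$ $(2\le j\le b-2)$, $P_{b-1}=\langle h_{b-2},g_b,g_{b+1}\rangle$. Let $\mathbb R^2_1$ be $\mathbb R^3$ with $B(x,y)=x_1y_1+x_2y_2-x_3y_3$. For a hyperbolic $g\in SO^0(2,1)$ let $X_g^-,X_g^+$ be future-pointing null eigenvectors with eigenvalues $\lambda,\lambda^{-1}$, $0<\lambda<1$, and $X^0_g$ the fixed vector with $B(X^0_g,X^0_g)=1$ and $\det(X_g^0,X_g^-,X_g^+)>0$.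 A cocycle is a map $u:\pi_1(S_{b+1})\to\mathbb R^2_1$ with $u(\gamma\delta)=\rho(\gamma)u(\delta)+u(\gamma)$; its Margulis invariant is $\alpha_u(\gamma)=B(u(\gamma),X^0_{\rho(\gamma)})$. The affine twist $\mathrm{AT}_k$ $(1\le k\le b-2)$ is the cocycle which vanishes on $P_1,\dots,P_k$ and equals the coboundary $\gamma\mapsto v-\rho(\gamma)v$ with $v=X^0_{\rho(h_k)}$ on $P_{k+1},\dots,P_{b-1}$. Identify $\mathbb R^2_1$ with $\mathfrak{sl}_2(\mathbb R)$ (with the form $\frac12\mathrm{tr}(XY)$) by the isometry $\psi:\begin{pmatrix}v_1&v_2\\v_3&-v_1\end{pmatrix}\mapsto\left(v_1,\frac{v_2+v_3}2,\frac{-v_2+v_3}2\right)$. Given a cocycle $u$, let $\tilde\gamma\in SL(2,\mathbb R)$ be a lift of $\rho(\gamma)$, let $\iota_t(\gamma)=\tilde\gamma\exp(t\,u(\gamma)+O(t^2))$ for all $\gamma$ (or $\iota_t(\gamma)=\exp(t\,u(\gamma)+O(t^2))\,\tilde\gamma$ for all $\gamma$), and let $L^u_\gamma(t)=\ell(\iota_t(\gamma))$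 be the translation length, where $\ell(A)=-2\log\mu$ if $0<\mu<1$ and $\mu$ or $-\mu$ is an eigenvalue of $A$. Fix $1\le l\le b-2$ and let $f_l=g_{l+2}^{-1}g_{l+1}^{-1}$. The closed geodesics of $h_l$ and $f_l$ on $S_{b+1}$ meet in exactly two points; let $\theta_l,\theta_l'\in(0,\pi)$ be the angles at these points from the forward direction of $h_l$ to the ray of $f_l$ that lies on the left of $h_l$. Then, for every cocycle $u_0$, all $t_1,\dots,t_{b-2}\in\mathbb R$, and $u=u_0+\sum_{k=1}^{b-2}t_k\,\mathrm{AT}_k$, the function $L^u_{f_l}$ is differentiable at $0$ and $$\frac12\,\frac{dL^{u}_{f_l}}{dt}(0)=\alpha_{u_0}(f_l)+t_l\,(\cos\theta_l+\cos\theta_l').$$ -/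

import Mathlib

open Filter Topology Asymptotics

noncomputable section

namespace AffineDeformation

/-! ## Minkowski space and its isometries -/

/-- The three-dimensional Lorentzian vector space. -/
abbrev V : Type := Fin 3 → ℝ

/-- The Lorentzian inner product of signature `(2, 1)`. -/
def B (x y : V) : ℝ := x 0 * y 0 + x 1 * y 1 - x 2 * y 2

/-- The determinant of three vectors. -/
def det3 (x y z : V) : ℝ := Matrix.det (Matrix.of ![x, y, z])

lemma B_neg_neg (x y : V) : B (-x) (-y) = B x y := by
  simp [B]

/-- The identity component `SO⁰(2,1)`: the matrices of determinant one that preserve `B` and map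
future-pointing timelike vectors to future-pointing ones. -/
def SO21 : Subgroup (Matrix.SpecialLinearGroup (Fin 3) ℝ) where
  carrier := {A | (∀ x y : V, B (A.1.mulVec x) (A.1.mulVec y) = B x y) ∧
    ∀ x : V, B x x < 0 → 0 < x 2 → 0 < (A.1.mulVec x) 2}
  one_mem' := by
    constructor <;> simp
  mul_mem' := by
    rintro A C ⟨hA, hA'⟩ ⟨hC, hC'⟩
    constructor
    · intro x y
      simp only [Matrix.SpecialLinearGroup.coe_mul, ← Matrix.mulVec_mulVec, hA, hC]
    · intro x hx hx2
      simp only [Matrix.SpecialLinearGroup.coe_mul, ← Matrix.mulVec_mulVec]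
      exact hA' _ (by rw [hC]; exact hx) (hC' x hx hx2)
  inv_mem' := by
    rintro A ⟨hA, hA'⟩
    have key : ∀ x : V, A.1.mulVec ((A⁻¹).1.mulVec x) = x := by
      intro x
      rw [Matrix.mulVec_mulVec, ← Matrix.SpecialLinearGroup.coe_mul, mul_inv_cancel]
      simp
    have hB : ∀ x y : V, B ((A⁻¹).1.mulVec x) ((A⁻¹).1.mulVec y) = B x y := by
      intro x y
      rw [← hA, key, key]
    refine ⟨hB, ?_⟩
    intro x hx hx2
    by_contra hneg
    have hy : B ((A⁻¹).1.mulVec x) ((A⁻¹).1.mulVec x) < 0 := by rw [hB]; exact hx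
    have hne : ((A⁻¹).1.mulVec x) 2 ≠ 0 := by
      intro h0
      simp only [B, h0] at hy
      nlinarith [sq_nonneg (((A⁻¹).1.mulVec x) 0), sq_nonneg (((A⁻¹).1.mulVec x) 1)]
    have hpos : 0 < (-((A⁻¹).1.mulVec x)) 2 := by
      simp only [Pi.neg_apply]
      have := lt_of_le_of_ne (not_lt.mp hneg) hne
      linarith
    have h := hA' _ (by rw [B_neg_neg]; exact hy) hpos
    rw [Matrix.mulVec_neg, key] at h
    simp only [Pi.neg_apply] at h
    linarith

/-- The linear action of `SO⁰(2,1)` on Minkowski space. -/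
def act (g : SO21) (x : V) : V := g.1.1.mulVec x

lemma act_one (x : V) : act 1 x = x := by
  simp [act]

lemma act_mul (g h : SO21) (x : V) : act (g * h) x = act g (act h x) := by
  simp [act, Matrix.mulVec_mulVec]

lemma act_add (g : SO21) (x y : V) : act g (x + y) = act g x + act g y :=
  Matrix.mulVec_add _ _ _

lemma act_sub (g : SO21) (x y : V) : act g (x - y) = act g x - act g y :=
  Matrix.mulVec_sub _ _ _

lemma act_zero (g : SO21) : act g 0 = 0 :=
  Matrix.mulVec_zero _

lemma act_inv_act (g : SO21) (x : V) : act g⁻¹ (act g x) = x := by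
  rw [← act_mul, inv_mul_cancel, act_one]

lemma act_act_inv (g : SO21) (x : V) : act g (act g⁻¹ x) = x := by
  rw [← act_mul, mul_inv_cancel, act_one]

/-- The normalized eigenvectors of a hyperbolic element `g`: two future-pointing null vectors `Xm`,
`Xp` of Euclidean length one, with eigenvalues `lam`, `lam⁻¹` where `0 < lam < 1`, and a fixed unit
spacelike vector `X0`, such that `(X0, Xm, Xp)` is positively oriented. -/
structure EigenFrame (g : SO21) where
  lam : ℝ
  Xm : V
  X0 : V
  Xp : V
  lam_pos : 0 < lam
  lam_lt_one : lam < 1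
  act_Xm : act g Xm = lam • Xm
  act_X0 : act g X0 = X0
  act_Xp : act g Xp = lam⁻¹ • Xp
  null_Xm : B Xm Xm = 0
  null_Xp : B Xp Xp = 0
  unit_X0 : B X0 X0 = 1
  length_Xm : Xm 0 ^ 2 + Xm 1 ^ 2 + Xm 2 ^ 2 = 1
  length_Xp : Xp 0 ^ 2 + Xp 1 ^ 2 + Xp 2 ^ 2 = 1
  future_Xm : 0 < Xm 2
  future_Xp : 0 < Xp 2
  oriented : 0 < det3 X0 Xm Xp

/-- `g` is hyperbolic. -/
def IsHyperbolic (g : SO21) : Prop := Nonempty (EigenFrame g)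

open Classical in
/-- The neutral eigenvector `X⁰` of a hyperbolic element (zero if `g` is not hyperbolic). -/
def neutral (g : SO21) : V :=
  if h : IsHyperbolic g then (Classical.choice h).X0 else 0

lemma act_neutral (g : SO21) : act g (neutral g) = neutral g := by
  unfold neutral
  split_ifs with h
  · exact (Classical.choice h).act_X0
  · exact act_zero g

/-! ## The hyperbolic plane -/

/-- The hyperbolic plane: the future-pointing unit timelike vectors. -/
def HypPlane : Type := {x : V // B x x = -1 ∧ 0 < x 2}

instance : MulAction SO21 HypPlane where
  smul g x := ⟨act g x.1, (g.2.1 x.1 x.1).trans x.2.1,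
    g.2.2 x.1 (by rw [x.2.1]; norm_num) x.2.2⟩
  one_smul x := Subtype.ext (act_one x.1)
  mul_smul g h x := Subtype.ext (act_mul g h x.1)

/-- The invariant line of a hyperbolic element in the hyperbolic plane. -/
def axis (g : SO21) : Set HypPlane := {x | IsHyperbolic g ∧ B x.1 (neutral g) = 0}

/-- `v` is the unit tangent vector at `x` to the invariant line of `g`, in the direction in which
`g` translates. -/
def IsForwardTangent (g : SO21) (x : HypPlane) (v : V) : Prop :=
  B v x.1 = 0 ∧ B v (neutral g) = 0 ∧ B v v = 1 ∧ 0 < B (act g x.1) v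

/-- At a common point `x` of the axes of `h` and `f`, the number `θ ∈ (0, π)` is the angle from the
forward direction `s` of `h` to the ray (with direction `v`) of the axis of `f` which lies on the
left of `h`; that is, the counterclockwise angle from the axis of `h` to the axis of `f`. -/
def IsLeftAngle (h f : SO21) (x : HypPlane) (θ : ℝ) : Prop :=
  ∃ s v : V, IsForwardTangent h x s ∧ (IsForwardTangent f x v ∨ IsForwardTangent f x (-v)) ∧
    0 < det3 s v x.1 ∧ θ ∈ Set.Ioo 0 Real.pi ∧ Real.cos θ = B s v

/-! ## The sphere with `b + 1` holes -/

/-- The fundamental group of the sphere with `b + 1` holes, free on `g_1, …, g_b`. -/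
abbrev Pi1 (b : ℕ) : Type := FreeGroup (Fin b)

/-- The standard generators `g_1, …, g_b` (the value is `1` for other indices). The last peripheral
element `g_{b+1} = (g_1 ⋯ g_b)⁻¹` is `dividing b (b - 1)` below. -/
def gen (b i : ℕ) : Pi1 b :=
  if h : 1 ≤ i ∧ i ≤ b then FreeGroup.of ⟨i - 1, by omega⟩ else 1

/-- `h_j = g_{j+1}⁻¹ g_j⁻¹ ⋯ g_1⁻¹`. For `1 ≤ j ≤ b - 2` these are the dividing curves, and
`h_0 = g_1⁻¹`, `h_{b-1} = g_{b+1}`. -/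
def dividing (b : ℕ) : ℕ → Pi1 b
  | 0 => (gen b 1)⁻¹
  | j + 1 => (gen b (j + 2))⁻¹ * dividing b j

/-- The `j`-th pair of pants `P_j`, `1 ≤ j ≤ b - 1`, with boundary curves `h_{j-1}`, `g_{j+1}`,
`h_j`. As `h_0 = g_1⁻¹` and `h_{b-1} = g_{b+1}`, this contains the two pairs of pants at the ends:
`P_1 = ⟨g_1, g_2, h_1⟩` and `P_{b-1} = ⟨h_{b-2}, g_b, g_{b+1}⟩`. -/
def pants (b j : ℕ) : Subgroup (Pi1 b) :=
  Subgroup.closure {dividing b (j - 1), gen b (j + 1), dividing b j}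

/-- `f_l = g_{l+2}⁻¹ g_{l+1}⁻¹`. -/
def crossing (b l : ℕ) : Pi1 b := (gen b (l + 2))⁻¹ * (gen b (l + 1))⁻¹

/-- The ideal point of the hyperbolic plane at angle `φ`, as a null vector. -/
def idealPoint (φ : ℝ) : V := ![Real.cos φ, Real.sin φ, 1]

/-- `ρ` is the holonomy of a (complete, cusp-free) hyperbolic structure on the sphere with `b + 1`
holes, marked by the standard generators `g_1, …, g_{b+1}`, `g_1 ⋯ g_{b+1} = 1`.

Cut the surface along disjoint complete geodesic arcs, the `i`-th one (`1 ≤ i ≤ b`) joining the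
`i`-th hole to the last one, and develop the resulting disc into the hyperbolic plane: the image is
the region bounded by `2 b` pairwise disjoint geodesics, whose ideal endpoints are, in
counterclockwise order, `p 1, q 1 | r 1, s 1 | p 2, q 2 | r 2, s 2 | … | p b, q b | r b, s b`, and
`g_i` glues the side `(r i, s i)` to the side `(q i, p i)`. The ideal interval `(q i, r i)` closes
up to the `i`-th hole, and the intervals `(s i, p (i + 1))` and `(s b, p 1)` to the last one. With
this orientation the surface lies to the right of each of the boundary geodesics
`g_1, …, g_{b+1}`. -/
def IsHolonomy {b : ℕ} (ρ : Pi1 b →* SO21) : Prop :=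
  ∃ p q r s : Fin b → ℝ,
    (∀ i, p i < q i ∧ q i < r i ∧ r i < s i) ∧
    (∀ i j, i < j → s i < p j) ∧
    (∀ i j, s i < p j + 2 * Real.pi) ∧
    ∀ i, (∃ c : ℝ, 0 < c ∧ act (ρ (FreeGroup.of i)) (idealPoint (r i)) = c • idealPoint (q i)) ∧
      (∃ c : ℝ, 0 < c ∧ act (ρ (FreeGroup.of i)) (idealPoint (s i)) = c • idealPoint (p i))

variable {b : ℕ} (ρ : Pi1 b →* SO21)

/-- The quotient of the hyperbolic plane by the holonomy group. -/
abbrev Surface : Type := MulAction.orbitRel.Quotient ρ.range HypPlane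

/-- The projection of the hyperbolic plane onto the surface. -/
def proj (x : HypPlane) : Surface ρ := Quotient.mk _ x

/-- The closed geodesic on the surface determined by `γ`. -/
def closedGeodesic (γ : Pi1 b) : Set (Surface ρ) := proj ρ '' axis (ρ γ)

/-- `θ` is the angle at the point `P` of the surface between the closed geodesics of `η` and `φ`,
measured on the left side of the former. It is read off at a lift of `P`, between lifts of the two
geodesics. -/
def IsSurfaceAngle (η φ : Pi1 b) (P : Surface ρ) (θ : ℝ) : Prop :=
  ∃ (x : HypPlane) (a c : Pi1 b), proj ρ x = P ∧
    x ∈ axis (ρ (a * η * a⁻¹)) ∧ x ∈ axis (ρ (c * φ * c⁻¹)) ∧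
    IsLeftAngle (ρ (a * η * a⁻¹)) (ρ (c * φ * c⁻¹)) x θ

/-! ## Cocycles -/

/-- The cocycle condition. -/
def IsCocycle (u : Pi1 b → V) : Prop :=
  ∀ γ δ : Pi1 b, u (γ * δ) = act (ρ γ) (u δ) + u γ

/-- The coboundary of a vector. -/
def coboundary (v : V) (γ : Pi1 b) : V := v - act (ρ γ) v

/-- The Margulis invariant `B (γ x - x, X⁰)` of the affine transformation `x ↦ ρ γ x + u γ`,
evaluated at the origin; it does not depend on the point `x`. -/
def margulis (u : Pi1 b → V) (γ : Pi1 b) : ℝ := B (u γ) (neutral (ρ γ))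

/-- The affine transformation `x ↦ g x + c`. -/
def affineMap (g : SO21) (c : V) : Equiv.Perm V where
  toFun x := act g x + c
  invFun x := act g⁻¹ (x - c)
  left_inv x := by simp [act_inv_act]
  right_inv x := by simp [act_act_inv]

/-- The cocycle with prescribed values on the free generators: the translational part of the affine
deformation which sends the `i`-th generator to `x ↦ ρ g_i x + c i`. -/
def cocycleOf (c : Fin b → V) (γ : Pi1 b) : V :=
  FreeGroup.lift (fun i => affineMap (ρ (FreeGroup.of i)) (c i)) γ 0

/-- The affine twist `AT_k`: the cocycle that vanishes on `g_i` for `i ≤ k + 1` and agrees with the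
coboundary of the neutral vector of `h_k` on `g_i` for `k + 2 ≤ i ≤ b`. -/
def affineTwist (k : ℕ) : Pi1 b → V :=
  cocycleOf ρ fun i =>
    if i.1 ≤ k then 0 else coboundary ρ (neutral (ρ (dividing b k))) (FreeGroup.of i)

/-- The defining property of the affine twist: a cocycle which is zero on `P_1, …, P_k` and equals
the coboundary of the neutral vector of `h_k` on `P_{k+1}, …, P_{b-1}`. -/
def IsAffineTwist (k : ℕ) (a : Pi1 b → V) : Prop :=
  IsCocycle ρ a ∧
    (∀ l, 1 ≤ l → l ≤ k → ∀ γ ∈ pants b l, a γ = 0) ∧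
    ∀ m, k + 1 ≤ m → m ≤ b - 1 → ∀ γ ∈ pants b m,
      a γ = coboundary ρ (neutral (ρ (dividing b k))) γ

lemma lift_affineMap (c : Fin b → V) (γ : Pi1 b) :
    ∀ x : V, FreeGroup.lift (fun i => affineMap (ρ (FreeGroup.of i)) (c i)) γ x =
      act (ρ γ) x + cocycleOf ρ c γ := by
  induction γ using FreeGroup.induction_on with
  | C1 => intro x; simp [cocycleOf, act_one]
  | of i => intro x; simp [cocycleOf, affineMap, act_zero]
  | inv_of i _ =>
    intro x
    simp only [cocycleOf, map_inv, FreeGroup.lift_apply_of]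
    change act _ (x - c i) = act _ x + act _ (0 - c i)
    rw [← act_add]; congr 1; abel
  | mul γ δ hγ hδ =>
    intro x
    have h0 : cocycleOf ρ c (γ * δ) = act (ρ γ) (cocycleOf ρ c δ) + cocycleOf ρ c γ := by
      conv_lhs => rw [cocycleOf, map_mul, Equiv.Perm.mul_apply]
      exact hγ _
    rw [h0, map_mul, Equiv.Perm.mul_apply, hδ, hγ, map_mul, act_mul, act_add, add_assoc]

lemma isCocycle_cocycleOf (c : Fin b → V) : IsCocycle ρ (cocycleOf ρ c) := by
  intro γ δ
  conv_lhs => rw [cocycleOf, map_mul, Equiv.Perm.mul_apply]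
  exact lift_affineMap ρ c γ _

lemma cocycleOf_of (c : Fin b → V) (i : Fin b) : cocycleOf ρ c (FreeGroup.of i) = c i := by
  simp [cocycleOf, affineMap, act_zero]

lemma isCocycle_coboundary (v : V) : IsCocycle ρ (coboundary ρ v) := by
  intro γ δ
  simp only [coboundary, map_mul, act_mul, act_sub]
  abel

variable {ρ}

lemma IsCocycle.one {u : Pi1 b → V} (hu : IsCocycle ρ u) : u 1 = 0 := by
  have h := hu 1 1
  simpa [act_one] using h

lemma IsCocycle.eq_mul {u v : Pi1 b → V} (hu : IsCocycle ρ u) (hv : IsCocycle ρ v)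
    {γ δ : Pi1 b} (h1 : u γ = v γ) (h2 : u δ = v δ) : u (γ * δ) = v (γ * δ) := by
  rw [hu, hv, h1, h2]

lemma IsCocycle.eq_inv {u v : Pi1 b → V} (hu : IsCocycle ρ u) (hv : IsCocycle ρ v)
    {γ : Pi1 b} (h : u γ = v γ) : u γ⁻¹ = v γ⁻¹ := by
  have h1 := hu γ⁻¹ γ
  have h2 := hv γ⁻¹ γ
  rw [inv_mul_cancel, hu.one] at h1
  rw [inv_mul_cancel, hv.one, ← h, h1] at h2
  exact add_left_cancel h2

lemma IsCocycle.eq_on_closure {u v : Pi1 b → V} (hu : IsCocycle ρ u) (hv : IsCocycle ρ v)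
    {S : Set (Pi1 b)} (h : ∀ γ ∈ S, u γ = v γ) : ∀ γ ∈ Subgroup.closure S, u γ = v γ := by
  intro γ hγ
  induction hγ using Subgroup.closure_induction with
  | mem x hx => exact h x hx
  | one => rw [hu.one, hv.one]
  | mul x y _ _ hx hy => exact hu.eq_mul hv hx hy
  | inv x _ hx => exact hu.eq_inv hv hx

variable (ρ)

lemma affineTwist_gen_low (k i : ℕ) (hi : i ≤ k + 1) : affineTwist ρ k (gen b i) = 0 := by
  unfold gen
  split_ifs with h
  · rw [affineTwist, cocycleOf_of, if_pos (by simp only; omega)]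
  · exact (isCocycle_cocycleOf ρ _).one

lemma affineTwist_gen_high (k i : ℕ) (hi : k + 2 ≤ i) :
    affineTwist ρ k (gen b i) = coboundary ρ (neutral (ρ (dividing b k))) (gen b i) := by
  unfold gen
  split_ifs with h
  · rw [affineTwist, cocycleOf_of, if_neg (by simp only; omega)]
  · rw [affineTwist, (isCocycle_cocycleOf ρ _).one, (isCocycle_coboundary ρ _).one]

lemma isCocycle_zero : IsCocycle ρ (fun _ => 0) := by
  intro γ δ
  simp [act_zero]

lemma affineTwist_dividing_low (k : ℕ) :
    ∀ j, j ≤ k → affineTwist ρ k (dividing b j) = 0 := by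
  have hc : IsCocycle ρ (affineTwist ρ k) := isCocycle_cocycleOf ρ _
  intro j
  induction j with
  | zero =>
    intro _
    exact hc.eq_inv (isCocycle_zero ρ) (affineTwist_gen_low ρ k 1 (by omega))
  | succ j ih =>
    intro hj
    exact hc.eq_mul (isCocycle_zero ρ)
      (hc.eq_inv (isCocycle_zero ρ) (affineTwist_gen_low ρ k (j + 2) (by omega))) (ih (by omega))

lemma affineTwist_dividing_high (k : ℕ) : ∀ j, k ≤ j → affineTwist ρ k (dividing b j) =
    coboundary ρ (neutral (ρ (dividing b k))) (dividing b j) := by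
  have hc : IsCocycle ρ (affineTwist ρ k) := isCocycle_cocycleOf ρ _
  intro j hj
  induction j, hj using Nat.le_induction with
  | base => rw [affineTwist_dividing_low ρ k k le_rfl, coboundary, act_neutral, sub_self]
  | succ j hj ih =>
    exact hc.eq_mul (isCocycle_coboundary ρ _) (hc.eq_inv (isCocycle_coboundary ρ _)
      (affineTwist_gen_high ρ k (j + 2) (by omega))) ih

/-- The affine twist has its defining property. -/
theorem isAffineTwist_affineTwist (k : ℕ) : IsAffineTwist ρ k (affineTwist ρ k) := by
  have hc : IsCocycle ρ (affineTwist ρ k) := isCocycle_cocycleOf ρ _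
  refine ⟨hc, ?_, ?_⟩
  · intro l hl hlk
    refine hc.eq_on_closure (isCocycle_zero ρ) ?_
    rintro γ (rfl | rfl | rfl)
    · exact affineTwist_dividing_low ρ k _ (by omega)
    · exact affineTwist_gen_low ρ k _ (by omega)
    · exact affineTwist_dividing_low ρ k _ (by omega)
  · intro m hm _
    refine hc.eq_on_closure (isCocycle_coboundary ρ _) ?_
    rintro γ (rfl | rfl | rfl)
    · exact affineTwist_dividing_high ρ k _ (by omega)
    · exact affineTwist_gen_high ρ k _ (by omega)
    · exact affineTwist_dividing_high ρ k _ (by omega)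

/-! ## Deformations of the hyperbolic structure -/

/-- The inverse of the isometry `ψ` from `sl₂(ℝ)`, with the form `tr (X Y) / 2`, to Minkowski space:
`ψ` sends `!![v₁, v₂; v₃, -v₁]` to `(v₁, (v₂ + v₃) / 2, (-v₂ + v₃) / 2)`. -/
def psiInv (v : V) : Matrix (Fin 2) (Fin 2) ℝ :=
  !![v 0, v 1 - v 2; v 1 + v 2, -v 0]

/-- `A` is a lift of `g` under `SL(2,ℝ) → PSL(2,ℝ) ≅ SO⁰(2,1)`, the adjoint action through `ψ`. -/
def IsLift (A : Matrix.SpecialLinearGroup (Fin 2) ℝ) (g : SO21) : Prop :=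
  ∀ v : V, psiInv (act g v) = A.1 * psiInv v * (A⁻¹).1

open Classical in
/-- The translation length `-2 log μ` of a hyperbolic element of `SL(2,ℝ)`, where `0 < μ < 1` and
`μ` or `-μ` is an eigenvalue (zero if there is no such `μ`). -/
def translationLength (A : Matrix.SpecialLinearGroup (Fin 2) ℝ) : ℝ :=
  if h : ∃ μ : ℝ, 0 < μ ∧ μ < 1 ∧ (A.1.charpoly.IsRoot μ ∨ A.1.charpoly.IsRoot (-μ)) then
    -2 * Real.log h.choose
  else 0

/-- `ι` is a deformation of the holonomy tangent to `u`: `ι 0` lifts `ρ`, and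
`ι t γ = ι 0 γ exp (t u(γ) + O(t²))` for every `γ`, where Minkowski space is identified with
`sl₂(ℝ)` by `ψ`. The deformations with `ι t γ = exp (t u(γ) + O(t²)) ι 0 γ` are admitted as well:
this is the form that a path of homomorphisms tangent to the cocycle `u` takes. -/
def IsDeformation (u : Pi1 b → V) (ι : ℝ → Pi1 b → Matrix.SpecialLinearGroup (Fin 2) ℝ) : Prop :=
  (∀ γ, IsLift (ι 0 γ) (ρ γ)) ∧
    ((∀ γ, ∃ R : ℝ → V, R =O[𝓝 0] (fun t => t ^ 2) ∧ ∀ᶠ t in 𝓝 (0 : ℝ),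
        (ι t γ).1 = (ι 0 γ).1 * NormedSpace.exp (psiInv (t • u γ + R t))) ∨
      (∀ γ, ∃ R : ℝ → V, R =O[𝓝 0] (fun t => t ^ 2) ∧ ∀ᶠ t in 𝓝 (0 : ℝ),
        (ι t γ).1 = NormedSpace.exp (psiInv (t • u γ + R t)) * (ι 0 γ).1))

end AffineDeformation

end

open AffineDeformation

/-!
The derivative formula has an analytic half and a geometric half.

*Analytic half.* A lift of a hyperbolic isometry `g` to `SL(2, ℝ)` is `a + β n`, where `n` is the
neutral vector regarded as a traceless matrix, `a² - β² = 1` and `a β > 0`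
(`IsAxisPair.exists_lift_eq`). The translation length is a function of the trace, so along a path
tangent to a cocycle `u` it changes at twice the rate `B (u γ) n`
(`IsAxisPair.hasDerivAt_translationLength`). The coefficient of `t k` is therefore the Margulis
invariant of the affine twist at the crossing curve `f`. The twist is zero or a coboundary on `f`
unless `k = l`, and then it contributes `B n_h n_f - B n_h n_f'`, where `h` is the dividing curve
and `f'` is the conjugate of `f` by `g_{l+2}`.

*Geometric half.* The neutral vector is the unit normal on the left of the axis, so at a crossing
point `B n_h n_f` is, up to the sign that tells in which direction `f` crosses `h`, the cosine of
the angle in question (`exists_leftAngle`). It remains to see that the two geodesics cross precisely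
at the images of the crossings of the axis of `h` with those of `f` and `f'`. The holonomy is in
Schottky position. By ping-pong the exterior of the `2 b` half-planes is a strict fundamental domain
of its orbit (`IsSchottky.eq_one_of_inDomain`), a positive word is hyperbolic with its ideal fixed
points in the arcs of its first letter and of the inverse of its last letter
(`IsSchottky.exists_axisPair`), and every point of its axis can be moved into the domain by an
element that conjugates the word to a cyclic permutation (`IsSchottky.exists_inDomain`). As `h⁻¹`
and `f⁻¹` are the positive words `g_1 ⋯ g_{l+1}` and `g_{l+1} g_{l+2}`, only finitely many pairs of
axes have to be compared, and the cyclic order of the arcs decides which of them cross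
(`IsSchottky.exists_conj_of_mem_axes`, `IsSchottky.exists_linked_axisPairs`).
-/

namespace AffineDeformation

/-! ### The Lorentzian cross product -/

/-- The Lorentzian cross product, characterized by `B (cross x y) z = det3 x y z`. -/
def cross (x y : V) : V :=
  ![x 1 * y 2 - x 2 * y 1, x 2 * y 0 - x 0 * y 2, x 1 * y 0 - x 0 * y 1]

lemma det3_eq (x y z : V) : det3 x y z =
    x 0 * (y 1 * z 2 - y 2 * z 1) - x 1 * (y 0 * z 2 - y 2 * z 0) +
      x 2 * (y 0 * z 1 - y 1 * z 0) := by
  simp [det3, Matrix.det_fin_three]; ring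

lemma B_cross (x y z : V) : B (cross x y) z = det3 x y z := by
  simp [B, cross, det3_eq]; ring

lemma B_comm (x y : V) : B x y = B y x := by simp only [B]; ring

lemma B_add_left (x y z : V) : B (x + y) z = B x z + B y z := by simp only [B, Pi.add_apply]; ring

lemma B_sub_left (x y z : V) : B (x - y) z = B x z - B y z := by simp only [B, Pi.sub_apply]; ring

lemma B_smul_left (c : ℝ) (x y : V) : B (c • x) y = c * B x y := by
  simp only [B, Pi.smul_apply, smul_eq_mul]; ring

lemma B_smul_right (c : ℝ) (x y : V) : B x (c • y) = c * B x y := by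
  simp only [B, Pi.smul_apply, smul_eq_mul]; ring

lemma B_sub_right (x y z : V) : B x (y - z) = B x y - B x z := by simp only [B, Pi.sub_apply]; ring

lemma B_zero_left (x : V) : B 0 x = 0 := by simp [B]

lemma ext_of_B {x y : V} (h : ∀ z, B x z = B y z) : x = y := by
  have h0 := h ![1, 0, 0]
  have h1 := h ![0, 1, 0]
  have h2 := h ![0, 0, 1]
  simp [B] at h0 h1 h2
  ext i; fin_cases i <;> assumption

lemma det3_cycle (x y z : V) : det3 x y z = det3 y z x := by simp only [det3_eq]; ring

lemma det3_swap (x y z : V) : det3 x y z = -det3 y x z := by simp only [det3_eq]; ring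

lemma det3_add_right (x y z w : V) : det3 x y (z + w) = det3 x y z + det3 x y w := by
  simp only [det3_eq, Pi.add_apply]; ring

lemma det3_smul_right (x y : V) (c : ℝ) (z : V) : det3 x y (c • z) = c * det3 x y z := by
  simp only [det3_eq, Pi.smul_apply, smul_eq_mul]; ring

lemma det3_smul_left (x y : V) (c : ℝ) (z : V) : det3 (c • x) y z = c * det3 x y z := by
  simp only [det3_eq, Pi.smul_apply, smul_eq_mul]; ring

lemma det3_smul_middle (x y : V) (c : ℝ) (z : V) : det3 x (c • y) z = c * det3 x y z := by
  simp only [det3_eq, Pi.smul_apply, smul_eq_mul]; ring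

lemma cross_smul_left (c : ℝ) (x y : V) : cross (c • x) y = c • cross x y := by
  ext i; fin_cases i <;> simp [cross] <;> ring

lemma cross_cross (x y z : V) : cross (cross x y) z = B y z • x - B x z • y := by
  ext i; fin_cases i <;> simp [cross, B] <;> ring

lemma cross_comm (x y : V) : cross x y = -cross y x := by
  ext i; fin_cases i <;> simp [cross] <;> ring

lemma B_cross_cross (x y z w : V) :
    B (cross x y) (cross z w) = B x w * B y z - B x z * B y w := by
  simp [cross, B]; ring

lemma B_act (g : SO21) (x y : V) : B (act g x) (act g y) = B x y := g.2.1 x y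

lemma B_act_left (g : SO21) (x y : V) : B (act g x) y = B x (act g⁻¹ y) := by
  rw [← B_act g⁻¹, act_inv_act]

lemma act_smul (g : SO21) (c : ℝ) (x : V) : act g (c • x) = c • act g x :=
  Matrix.mulVec_smul _ _ _

lemma det3_act (g : SO21) (x y z : V) : det3 (act g x) (act g y) (act g z) = det3 x y z := by
  have h : Matrix.of ![act g x, act g y, act g z] = Matrix.of ![x, y, z] * g.1.1.transpose := by
    ext i j
    fin_cases i <;> simp [act, Matrix.mul_apply, Matrix.mulVec, dotProduct, mul_comm]
  rw [det3, h, Matrix.det_mul, Matrix.det_transpose, g.1.2, mul_one, det3]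

lemma cross_act (g : SO21) (x y : V) : cross (act g x) (act g y) = act g (cross x y) := by
  apply ext_of_B
  intro z
  rw [B_cross, B_act_left, B_cross, ← det3_act g x y, act_act_inv]

/-! ### The causal cone -/

/-- The future-pointing causal vectors: they represent the points of the closed hyperbolic plane,
null vectors being ideal points. -/
def IsCausal (x : V) : Prop := B x x ≤ 0 ∧ 0 < x 2

lemma HypPlane.isCausal (x : HypPlane) : IsCausal x.1 := ⟨by rw [x.2.1]; norm_num, x.2.2⟩

/-- Two future-pointing causal vectors have a negative product unless they are proportional. -/
lemma IsCausal.proportional {x y : V} (hx : IsCausal x) (hy : IsCausal y) (h : 0 ≤ B x y) :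
    y 2 • x = x 2 • y := by
  obtain ⟨hx, hx2⟩ := hx
  obtain ⟨hy, hy2⟩ := hy
  simp only [B] at hx hy h
  have h1 : y 2 ^ 2 * (x 0 * x 0 + x 1 * x 1) ≤ y 2 ^ 2 * (x 2 * x 2) :=
    mul_le_mul_of_nonneg_left (by linarith) (by positivity)
  have h2 : x 2 ^ 2 * (y 0 * y 0 + y 1 * y 1) ≤ x 2 ^ 2 * (y 2 * y 2) :=
    mul_le_mul_of_nonneg_left (by linarith) (by positivity)
  have h3 : x 2 * y 2 * (x 2 * y 2) ≤ x 2 * y 2 * (x 0 * y 0 + x 1 * y 1) :=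
    mul_le_mul_of_nonneg_left (by linarith) (by positivity)
  have h4 : (y 2 * x 0 - x 2 * y 0) ^ 2 + (y 2 * x 1 - x 2 * y 1) ^ 2 ≤ 0 := by nlinarith
  have h5 : y 2 * x 0 - x 2 * y 0 = 0 := by
    refine pow_eq_zero_iff (two_ne_zero) |>.1 (le_antisymm ?_ (sq_nonneg _))
    linarith [sq_nonneg (y 2 * x 1 - x 2 * y 1)]
  have h6 : y 2 * x 1 - x 2 * y 1 = 0 := by
    refine pow_eq_zero_iff (two_ne_zero) |>.1 (le_antisymm ?_ (sq_nonneg _))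
    linarith [sq_nonneg (y 2 * x 0 - x 2 * y 0)]
  ext i
  fin_cases i
  · simpa using sub_eq_zero.1 h5
  · simpa using sub_eq_zero.1 h6
  · simp [mul_comm]

lemma IsCausal.B_le {x y : V} (hx : IsCausal x) (hy : IsCausal y) : B x y ≤ 0 := by
  by_contra! h
  have h1 : B (y 2 • x) y = B (x 2 • y) y := by rw [hx.proportional hy h.le]
  rw [B_smul_left, B_smul_left] at h1
  have := mul_pos hy.2 h
  have := mul_nonneg hx.2.le (neg_nonneg.2 hy.1)
  linarith

lemma isCausal_act (g : SO21) {x : V} (hx : IsCausal x) : IsCausal (act g x) := by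
  refine ⟨by rw [B_act]; exact hx.1, ?_⟩
  -- The image is a limit of future timelike vectors, so its last coordinate is nonnegative.
  have h0 : 0 ≤ act g x 2 := by
    by_contra! h
    set e : V := ![0, 0, 1] with he
    have key : ∀ t : ℝ, 0 < t → 0 < act g x 2 + t * act g e 2 := by
      intro t ht
      have h1 := g.2.2 (x + t • e) ?_ ?_
      · change 0 < act g (x + t • e) 2 at h1
        rwa [act_add, act_smul] at h1
      · have := hx.1
        have h2 := mul_pos ht hx.2
        simp [B, he] at this ⊢
        nlinarith
      · have := hx.2
        simp [he]; linarith
    have h1 := key 1 one_pos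
    have h2 : 0 < act g e 2 := by linarith
    have h3 := key (-(act g x 2) / (2 * act g e 2)) (by apply div_pos <;> linarith)
    have h4 : -(act g x 2) / (2 * act g e 2) * act g e 2 = -(act g x 2) / 2 := by
      field_simp
    linarith
  refine lt_of_le_of_ne h0 fun h => ?_
  have h1 : B (act g x) (act g x) ≤ 0 := by rw [B_act]; exact hx.1
  have h3 : act g x = 0 := by
    simp only [B, ← h] at h1
    have a0 : act g x 0 = 0 := by nlinarith [sq_nonneg (act g x 0), sq_nonneg (act g x 1)]
    have a1 : act g x 1 = 0 := by nlinarith [sq_nonneg (act g x 0), sq_nonneg (act g x 1)]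
    ext i; fin_cases i
    · exact a0
    · exact a1
    · exact h.symm
  have h4 := act_inv_act g x
  rw [h3, act_zero] at h4
  have := hx.2
  simp [← h4] at this

/-! ### Arcs of the circle at infinity and half-planes -/

/-- The linear form that vanishes on the geodesic with ideal endpoints `a`, `b`. For
`a < b < a + 2π` it is negative on the half-plane bounded by the arc `(a, b)` and positive on the
complementary half-plane. -/
noncomputable def side (a b : ℝ) (x : V) : ℝ := det3 (idealPoint a) (idealPoint b) x

lemma side_add (a b : ℝ) (x y : V) : side a b (x + y) = side a b x + side a b y :=
  det3_add_right _ _ _ _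

lemma side_smul (a b c : ℝ) (x : V) : side a b (c • x) = c * side a b x :=
  det3_smul_right _ _ _ _

lemma B_idealPoint (a : ℝ) : B (idealPoint a) (idealPoint a) = 0 := by
  have := Real.cos_sq_add_sin_sq a
  simp [B, idealPoint]; linarith

lemma isCausal_idealPoint (a : ℝ) : IsCausal (idealPoint a) :=
  ⟨(B_idealPoint a).le, by simp [idealPoint]⟩

lemma side_idealPoint (a b c : ℝ) : side a b (idealPoint c) =
    4 * (Real.sin ((b - a) / 2) * Real.sin ((c - b) / 2) * Real.sin ((c - a) / 2)) := by
  have e1 : side a b (idealPoint c) = Real.sin (b - a) + Real.sin (c - b) - Real.sin (c - a) := by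
    simp only [side, det3_eq, idealPoint, Real.sin_sub]
    simp; ring
  obtain ⟨x, hx⟩ : ∃ x, x = (b - a) / 2 := ⟨_, rfl⟩
  obtain ⟨y, hy⟩ : ∃ y, y = (c - b) / 2 := ⟨_, rfl⟩
  have h1 : b - a = 2 * x := by rw [hx]; ring
  have h2 : c - b = 2 * y := by rw [hy]; ring
  have h3 : c - a = 2 * (x + y) := by rw [hx, hy]; ring
  have h4 : (c - a) / 2 = x + y := by rw [hx, hy]; ring
  rw [e1, h4, ← hx, ← hy, h1, h2, h3, Real.sin_two_mul, Real.sin_two_mul, Real.sin_two_mul,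
    Real.sin_add, Real.cos_add]
  have := Real.cos_sq_add_sin_sq x
  have := Real.cos_sq_add_sin_sq y
  have e2 : Real.cos x ^ 2 = 1 - Real.sin x ^ 2 := by linarith
  have e3 : Real.cos y ^ 2 = 1 - Real.sin y ^ 2 := by linarith
  linear_combination (-2 * Real.sin y * Real.cos y) * e2 + (-2 * Real.sin x * Real.cos x) * e3

lemma side_idealPoint_pos {a b c : ℝ} (h1 : a < b) (h2 : b < c) (h3 : c < a + 2 * Real.pi) :
    0 < side a b (idealPoint c) := by
  rw [side_idealPoint]
  have s1 : 0 < Real.sin ((b - a) / 2) := Real.sin_pos_of_pos_of_lt_pi (by linarith) (by linarith)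
  have s2 : 0 < Real.sin ((c - b) / 2) := Real.sin_pos_of_pos_of_lt_pi (by linarith) (by linarith)
  have s3 : 0 < Real.sin ((c - a) / 2) := Real.sin_pos_of_pos_of_lt_pi (by linarith) (by linarith)
  positivity

lemma side_idealPoint_cycle (a b c : ℝ) :
    side a b (idealPoint c) = side b c (idealPoint a) := det3_cycle _ _ _

lemma side_swap (a b : ℝ) (x : V) : side a b x = -side b a x := det3_swap _ _ _

lemma side_idealPoint_pos' {a b c : ℝ} (h1 : c < a) (h2 : a < b) (h3 : b < c + 2 * Real.pi) :
    0 < side a b (idealPoint c) := by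
  rw [side_idealPoint_cycle, side_idealPoint_cycle]
  exact side_idealPoint_pos h1 h2 h3

/-- An ideal point between `a` and `b` lies on the negative side. -/
lemma side_idealPoint_neg {a b c : ℝ} (h1 : a < c) (h2 : c < b) (h3 : b < a + 2 * Real.pi) :
    side a b (idealPoint c) < 0 := by
  rw [side_swap, side_idealPoint_cycle]
  have := side_idealPoint_pos h1 h2 h3
  linarith

lemma exists_angle {x : V} (hx : B x x = 0) (hx2 : 0 < x 2) (a : ℝ) :
    ∃ φ, a ≤ φ ∧ φ < a + 2 * Real.pi ∧ x = x 2 • idealPoint φ := by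
  set z : ℂ := ⟨x 0, x 1⟩ with hz
  have hn : ‖z‖ = x 2 := by
    rw [Complex.norm_def, Real.sqrt_eq_iff_mul_self_eq_of_pos hx2, Complex.normSq_apply]
    simp only [B] at hx
    simp only [hz]; linarith
  have hc : ‖z‖ * Real.cos z.arg = x 0 := Complex.norm_mul_cos_arg z
  have hs : ‖z‖ * Real.sin z.arg = x 1 := Complex.norm_mul_sin_arg z
  refine ⟨toIcoMod Real.two_pi_pos a z.arg, left_le_toIcoMod _ _ _, toIcoMod_lt_right _ _ _, ?_⟩
  have e : toIcoMod Real.two_pi_pos a z.arg =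
    z.arg - (toIcoDiv Real.two_pi_pos a z.arg : ℤ) * (2 * Real.pi) := by
    rw [toIcoMod, zsmul_eq_mul]
  have ec : Real.cos (toIcoMod Real.two_pi_pos a z.arg) = Real.cos z.arg := by
    rw [e, Real.cos_sub_int_mul_two_pi]
  have es : Real.sin (toIcoMod Real.two_pi_pos a z.arg) = Real.sin z.arg := by
    rw [e, Real.sin_sub_int_mul_two_pi]
  ext i
  fin_cases i
  · simp [idealPoint, ec, ← hc, hn]
  · simp [idealPoint, es, ← hs, hn]
  · simp [idealPoint]

/-- A point of the half-plane bounded by the arc `[a, b]` lies on a chord, parallel to the boundary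
geodesic in the Klein model, whose endpoints are in `[a, b]`. -/
lemma exists_chord {a b : ℝ} (hab : a < b) (hb : b < a + 2 * Real.pi) {x : V} (hx : IsCausal x)
    (h : side a b x ≤ 0) : ∃ φ ψ s t : ℝ, φ ∈ Set.Icc a b ∧ ψ ∈ Set.Icc a b ∧ 0 ≤ s ∧ 0 ≤ t ∧
      0 < s + t ∧ x = s • idealPoint φ + t • idealPoint ψ := by
  obtain ⟨hB, h2⟩ := hx
  obtain ⟨m, hm⟩ : ∃ m, m = (a + b) / 2 := ⟨_, rfl⟩
  obtain ⟨e, he⟩ : ∃ e, e = (b - a) / 2 := ⟨_, rfl⟩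
  have ha' : a = m - e := by rw [hm, he]; ring
  have hb' : b = m + e := by rw [hm, he]; ring
  have he0 : 0 < e := by rw [he]; linarith
  have hepi : e < Real.pi := by rw [he]; linarith
  set X : ℝ := x 0 * Real.cos m + x 1 * Real.sin m with hX
  set Y : ℝ := -(x 0 * Real.sin m) + x 1 * Real.cos m with hY
  have hm1 := Real.cos_sq_add_sin_sq m
  have he1 := Real.cos_sq_add_sin_sq e
  have hside : side a b x = 2 * Real.sin e * (x 2 * Real.cos e - X) := by
    simp only [side, det3_eq, idealPoint, ha', hb', Real.cos_add, Real.cos_sub, Real.sin_add,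
      Real.sin_sub, hX]
    simp
    linear_combination (2 * x 2 * Real.cos e * Real.sin e) * hm1
  have hse : 0 < Real.sin e := Real.sin_pos_of_pos_of_lt_pi he0 hepi
  have hXe : x 2 * Real.cos e ≤ X := by
    rw [hside] at h
    by_contra! hc
    have := mul_pos (mul_pos two_pos hse) (sub_pos.2 hc)
    linarith
  have hXY : X ^ 2 + Y ^ 2 ≤ x 2 ^ 2 := by
    have : X ^ 2 + Y ^ 2 = x 0 ^ 2 + x 1 ^ 2 := by
      rw [hX, hY]; linear_combination (x 0 ^ 2 + x 1 ^ 2) * hm1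
    simp only [B] at hB
    rw [this]; linarith
  have hX2 : X ≤ x 2 := by nlinarith [sq_nonneg Y]
  have hX2' : -(x 2) ≤ X := by nlinarith [sq_nonneg Y]
  obtain ⟨δ, hδ⟩ : ∃ δ, δ = Real.arccos (X / x 2) := ⟨_, rfl⟩
  have hcos : x 2 * Real.cos δ = X := by
    rw [hδ, Real.cos_arccos (by rw [le_div_iff₀ h2]; linarith) (by rw [div_le_one h2]; exact hX2)]
    field_simp
  have hδ0 : 0 ≤ δ := by rw [hδ]; exact Real.arccos_nonneg _
  have hδe : δ ≤ e := by
    rw [hδ, ← Real.arccos_cos he0.le hepi.le]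
    apply Real.arccos_le_arccos
    rw [le_div_iff₀ h2]; linarith
  have hsδ : 0 ≤ Real.sin δ := Real.sin_nonneg_of_nonneg_of_le_pi hδ0 (by linarith)
  have hδ1 := Real.cos_sq_add_sin_sq δ
  have hYs : |Y| ≤ x 2 * Real.sin δ := by
    apply abs_le_of_sq_le_sq _ (by positivity)
    rw [← hcos] at hXY
    nlinarith
  have hY1 := abs_le.1 hYs
  have hx0 : x 0 = X * Real.cos m - Y * Real.sin m := by
    rw [hX, hY]; linear_combination (-x 0) * hm1
  have hx1 : x 1 = X * Real.sin m + Y * Real.cos m := by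
    rw [hX, hY]; linear_combination (-x 1) * hm1
  -- The point is a convex combination of the points at angles `m ± δ`.
  obtain ⟨k, hk1, hk2, hk⟩ : ∃ k : ℝ, -1 ≤ k ∧ k ≤ 1 ∧ Y = k * (x 2 * Real.sin δ) := by
    rcases hsδ.eq_or_lt with h0 | h0
    · refine ⟨0, by norm_num, by norm_num, ?_⟩
      rw [← h0] at hY1
      linarith
    · have hp : 0 < x 2 * Real.sin δ := by positivity
      refine ⟨Y / (x 2 * Real.sin δ), ?_, ?_, ?_⟩
      · rw [le_div_iff₀ hp]; linarith
      · rw [div_le_one hp]; exact hY1.2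
      · field_simp
  refine ⟨m + δ, m - δ, x 2 * ((1 + k) / 2), x 2 * ((1 - k) / 2), ⟨?_, ?_⟩, ⟨?_, ?_⟩,
    ?_, ?_, ?_, ?_⟩
  any_goals linarith
  · exact mul_nonneg h2.le (by linarith)
  · exact mul_nonneg h2.le (by linarith)
  · ext i
    fin_cases i
    · simp [idealPoint, Real.cos_add, Real.cos_sub, hx0, hk, ← hcos]; ring
    · simp [idealPoint, Real.sin_add, Real.sin_sub, hx1, hk, ← hcos]; ring
    · simp [idealPoint]; ring

lemma pos_of_combination {s t u v : ℝ} (hs : 0 ≤ s) (ht : 0 ≤ t) (hst : 0 < s + t) (hu : 0 < u)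
    (hv : 0 < v) : 0 < s * u + t * v := by
  rcases hs.eq_or_lt with h | h
  · rw [← h] at hst ⊢
    have : 0 < t := by linarith
    positivity
  · have := mul_pos h hu
    have := mul_nonneg ht hv.le
    linarith

/-- The closed half-planes bounded by disjoint closed arcs are disjoint. -/
lemma side_pos_of_disjoint {a b c d : ℝ} (hab : a < b) (hcd : c < d)
    (h : (b < c ∧ d < a + 2 * Real.pi) ∨ (d < a ∧ b < c + 2 * Real.pi)) {x : V} (hx : IsCausal x)
    (hs : side a b x ≤ 0) : 0 < side c d x := by
  have hb : b < a + 2 * Real.pi := by rcases h with h | h <;> linarith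
  obtain ⟨φ, ψ, s, t, hφ, hψ, hs0, ht0, hst, rfl⟩ := exists_chord hab hb hx hs
  have key : ∀ φ ∈ Set.Icc a b, 0 < side c d (idealPoint φ) := by
    rintro φ ⟨h1, h2⟩
    rcases h with h | h
    · exact side_idealPoint_pos' (by linarith) hcd (by linarith)
    · exact side_idealPoint_pos hcd (by linarith) (by linarith)
  rw [side_add, side_smul, side_smul]
  exact pos_of_combination hs0 ht0 hst (key φ hφ) (key ψ hψ)

/-- An isometry that maps an arc into itself fixes an ideal point of the arc. -/
lemma exists_fixed_idealPoint (g : SO21) {a b : ℝ} (hab : a < b) (hb : b < a + 2 * Real.pi)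
    (h : ∀ φ ∈ Set.Icc a b, side a b (act g (idealPoint φ)) ≤ 0) :
    ∃ φ ∈ Set.Icc a b, ∃ c : ℝ, 0 < c ∧ act g (idealPoint φ) = c • idealPoint φ := by
  have himg : ∀ φ ∈ Set.Icc a b, ∃ ψ ∈ Set.Icc a b, ∃ c : ℝ, 0 < c ∧
      act g (idealPoint φ) = c • idealPoint ψ := by
    intro φ hφ
    have hc := isCausal_act g (isCausal_idealPoint φ)
    obtain ⟨ψ, h1, h2, h3⟩ := exists_angle (x := act g (idealPoint φ))
      (by rw [B_act, B_idealPoint]) hc.2 a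
    refine ⟨ψ, ⟨h1, ?_⟩, _, hc.2, h3⟩
    by_contra! h4
    have h5 := h φ hφ
    rw [h3, side_smul] at h5
    have := mul_pos hc.2 (side_idealPoint_pos hab h4 h2)
    linarith
  -- For an angle `τ` outside the arc, `side φ (g φ) τ` has the sign of `g φ - φ`.
  obtain ⟨τ, hτ1, hτ2⟩ : ∃ τ, b < τ ∧ τ < a + 2 * Real.pi := exists_between hb
  let G : ℝ → ℝ := fun φ => det3 (idealPoint φ) (act g (idealPoint φ)) (idealPoint τ)
  have hG : ContinuousOn G (Set.Icc a b) := by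
    apply Continuous.continuousOn
    have hI : Continuous idealPoint := by
      apply continuous_pi
      intro i
      fin_cases i
      · simpa [idealPoint] using Real.continuous_cos
      · simpa [idealPoint] using Real.continuous_sin
      · simpa [idealPoint] using continuous_const
    have hA : Continuous fun φ => act g (idealPoint φ) :=
      Continuous.matrix_mulVec continuous_const hI
    have hI' := fun i => (continuous_apply i).comp hI
    have hA' := fun i => (continuous_apply i).comp hA
    have e : G = fun φ => idealPoint φ 0 * (act g (idealPoint φ) 1 * idealPoint τ 2 -
        act g (idealPoint φ) 2 * idealPoint τ 1) - idealPoint φ 1 *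
        (act g (idealPoint φ) 0 * idealPoint τ 2 - act g (idealPoint φ) 2 * idealPoint τ 0) +
      idealPoint φ 2 * (act g (idealPoint φ) 0 * idealPoint τ 1 -
        act g (idealPoint φ) 1 * idealPoint τ 0) := funext fun φ => det3_eq _ _ _
    rw [e]
    have a0 := hI' 0
    have a1 := hI' 1
    have a2 := hI' 2
    have c0 := hA' 0
    have c1 := hA' 1
    have c2 := hA' 2
    simp only [Function.comp_def] at a0 a1 a2 c0 c1 c2
    fun_prop
  have hval : ∀ φ ψ c : ℝ, act g (idealPoint φ) = c • idealPoint ψ →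
      G φ = c * (4 * (Real.sin ((ψ - φ) / 2) * Real.sin ((τ - ψ) / 2) *
        Real.sin ((τ - φ) / 2))) := by
    intro φ ψ c hc
    simp only [G]
    rw [hc, det3_smul_middle, ← side_idealPoint, side]
  have hτs : ∀ φ ∈ Set.Icc a b, 0 < Real.sin ((τ - φ) / 2) := fun φ hφ =>
    Real.sin_pos_of_pos_of_lt_pi (by linarith [hφ.2]) (by linarith [hφ.1])
  have ha : 0 ≤ G a := by
    obtain ⟨ψ, hψ, c, hc, h1⟩ := himg a ⟨le_rfl, hab.le⟩
    rw [hval _ _ _ h1]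
    have := hτs a ⟨le_rfl, hab.le⟩
    have := hτs ψ hψ
    have : 0 ≤ Real.sin ((ψ - a) / 2) :=
      Real.sin_nonneg_of_nonneg_of_le_pi (by linarith [hψ.1]) (by linarith [hψ.2])
    positivity
  have hbG : G b ≤ 0 := by
    obtain ⟨ψ, hψ, c, hc, h1⟩ := himg b ⟨hab.le, le_rfl⟩
    rw [hval _ _ _ h1]
    have h2 := hτs b ⟨hab.le, le_rfl⟩
    have h3 := hτs ψ hψ
    have h4 : 0 ≤ Real.sin ((b - ψ) / 2) :=
      Real.sin_nonneg_of_nonneg_of_le_pi (by linarith [hψ.2]) (by linarith [hψ.1])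
    have h5 : Real.sin ((ψ - b) / 2) = -Real.sin ((b - ψ) / 2) := by
      rw [← Real.sin_neg]; congr 1; ring
    rw [h5]
    have := mul_nonneg hc.le (mul_nonneg (mul_nonneg h4 h3.le) h2.le)
    linarith
  obtain ⟨φ, hφ, h0⟩ := intermediate_value_Icc' hab.le hG ⟨hbG, ha⟩
  obtain ⟨ψ, hψ, c, hc, h1⟩ := himg φ hφ
  refine ⟨φ, hφ, c, hc, ?_⟩
  rw [hval _ _ _ h1] at h0
  have h2 := hτs φ hφ
  have h3 := hτs ψ hψ
  have h4 : Real.sin ((ψ - φ) / 2) = 0 := by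
    have : c * 4 * Real.sin ((τ - ψ) / 2) * Real.sin ((τ - φ) / 2) ≠ 0 := by positivity
    apply (mul_eq_zero.1 (?_ : Real.sin ((ψ - φ) / 2) * (c * 4 * Real.sin ((τ - ψ) / 2) *
      Real.sin ((τ - φ) / 2)) = 0)).resolve_right this
    linarith
  have h5 := (Real.sin_eq_zero_iff_of_lt_of_lt (by linarith [hφ.2, hψ.1, hφ.1, hψ.2])
    (by linarith [hφ.2, hψ.1, hφ.1, hψ.2])).1 h4
  have h6 : ψ = φ := by linarith
  rw [h1, h6]

/-! ### Axes and neutral vectors of hyperbolic isometries -/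

/-- `N₁` and `N₂` represent the attracting and the repelling ideal fixed point of `g`, and `c` is
the eigenvalue at the attracting one. -/
structure IsAxisPair (g : SO21) (N₁ N₂ : V) (c : ℝ) : Prop where
  one_lt : 1 < c
  null₁ : B N₁ N₁ = 0
  null₂ : B N₂ N₂ = 0
  future₁ : 0 < N₁ 2
  future₂ : 0 < N₂ 2
  act₁ : act g N₁ = c • N₁
  act₂ : act g N₂ = c⁻¹ • N₂

namespace IsAxisPair

variable {g : SO21} {N₁ N₂ : V} {c : ℝ}

lemma isCausal₁ (h : IsAxisPair g N₁ N₂ c) : IsCausal N₁ := ⟨h.null₁.le, h.future₁⟩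

lemma isCausal₂ (h : IsAxisPair g N₁ N₂ c) : IsCausal N₂ := ⟨h.null₂.le, h.future₂⟩

lemma pos (h : IsAxisPair g N₁ N₂ c) : 0 < c := one_pos.trans h.one_lt

lemma inv_lt (h : IsAxisPair g N₁ N₂ c) : c⁻¹ < c := (inv_lt_one_of_one_lt₀ h.one_lt).trans h.one_lt

lemma inv (h : IsAxisPair g N₁ N₂ c) : IsAxisPair g⁻¹ N₂ N₁ c where
  one_lt := h.one_lt
  null₁ := h.null₂
  null₂ := h.null₁
  future₁ := h.future₂
  future₂ := h.future₁
  act₁ := by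
    have h1 : N₂ = c • act g N₂ := by rw [h.act₂, smul_smul, mul_inv_cancel₀ h.pos.ne', one_smul]
    conv_lhs => rw [h1]
    rw [act_smul, act_inv_act]
  act₂ := by
    have h1 : N₁ = c⁻¹ • act g N₁ := by
      rw [h.act₁, smul_smul, inv_mul_cancel₀ h.pos.ne', one_smul]
    conv_lhs => rw [h1]
    rw [act_smul, act_inv_act]

lemma conj (h : IsAxisPair g N₁ N₂ c) (k : SO21) :
    IsAxisPair (k * g * k⁻¹) (act k N₁) (act k N₂) c where
  one_lt := h.one_lt
  null₁ := by rw [B_act, h.null₁]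
  null₂ := by rw [B_act, h.null₂]
  future₁ := (isCausal_act k h.isCausal₁).2
  future₂ := (isCausal_act k h.isCausal₂).2
  act₁ := by rw [act_mul, act_mul, act_inv_act, h.act₁, act_smul]
  act₂ := by rw [act_mul, act_mul, act_inv_act, h.act₂, act_smul]

lemma eq_smul_of_act_eq {x y : V} {c d : ℝ} (hx : IsCausal x) (hy : IsCausal y)
    (hgx : act g x = c • x) (hgy : act g y = d • y) (hcd : c * d ≠ 1) :
    y 2 • x = x 2 • y := by
  apply hx.proportional hy
  have h1 := B_act g x y
  rw [hgx, hgy, B_smul_left, B_smul_right, ← mul_assoc] at h1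
  have h2 : (c * d - 1) * B x y = 0 := by linarith
  rcases mul_eq_zero.1 h2 with h | h
  · exact absurd (by linarith) hcd
  · exact h.ge

lemma B_neg (h : IsAxisPair g N₁ N₂ c) : B N₁ N₂ < 0 := by
  by_contra! h0
  have h1 := h.isCausal₁.proportional h.isCausal₂ h0
  have h2 := congrArg (act g) h1
  rw [act_smul, act_smul, h.act₁, h.act₂] at h2
  have h3 := congrFun h2 2
  simp only [Pi.smul_apply, smul_eq_mul] at h3
  have h4 := mul_pos h.future₁ h.future₂
  have h5 : (c - c⁻¹) * (N₁ 2 * N₂ 2) = 0 := by linear_combination h3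
  have := mul_pos (sub_pos.2 h.inv_lt) h4
  linarith

/-- The attracting ideal fixed point is unique. -/
lemma attracting_unique (h : IsAxisPair g N₁ N₂ c) {N₁' N₂' : V} {c' : ℝ}
    (h' : IsAxisPair g N₁' N₂' c') : N₁' = (N₁' 2 / N₁ 2) • N₁ := by
  have h1 := eq_smul_of_act_eq h'.isCausal₁ h.isCausal₁ h'.act₁ h.act₁
    (by nlinarith [h.one_lt, h'.one_lt])
  rw [div_eq_inv_mul, mul_smul, ← h1, smul_smul, inv_mul_cancel₀ h.future₁.ne', one_smul]

lemma repelling_unique (h : IsAxisPair g N₁ N₂ c) {N₁' N₂' : V} {c' : ℝ}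
    (h' : IsAxisPair g N₁' N₂' c') : N₂' = (N₂' 2 / N₂ 2) • N₂ :=
  h.inv.attracting_unique h'.inv

/-- The unit fixed vector, in terms of the ideal fixed points. -/
lemma eq_of_eigenFrame (h : IsAxisPair g N₁ N₂ c) (e : EigenFrame g) :
    e.X0 = (B N₁ N₂)⁻¹ • cross N₁ N₂ := by
  have hp : IsAxisPair g e.Xp e.Xm e.lam⁻¹ :=
    { one_lt := (one_lt_inv₀ e.lam_pos).2 e.lam_lt_one
      null₁ := e.null_Xp
      null₂ := e.null_Xm
      future₁ := e.future_Xp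
      future₂ := e.future_Xm
      act₁ := e.act_Xp
      act₂ := by rw [inv_inv]; exact e.act_Xm }
  have h1 : B N₁ e.X0 = 0 := by
    have := B_act g N₁ e.X0
    rw [e.act_X0, h.act₁, B_smul_left] at this
    have h2 : (c - 1) * B N₁ e.X0 = 0 := by linarith
    exact (mul_eq_zero.1 h2).resolve_left (by linarith [h.one_lt])
  have h2 : B N₂ e.X0 = 0 := by
    have := B_act g⁻¹ N₂ e.X0
    rw [show act g⁻¹ e.X0 = e.X0 by conv_lhs => rw [← e.act_X0, act_inv_act], h.inv.act₁,
      B_smul_left] at this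
    have h2 : (c - 1) * B N₂ e.X0 = 0 := by linarith
    exact (mul_eq_zero.1 h2).resolve_left (by linarith [h.one_lt])
  have hneg := h.B_neg
  have hw : B (cross N₁ N₂) (cross N₁ N₂) = B N₁ N₂ ^ 2 := by
    rw [B_cross_cross, h.null₁, B_comm]; ring
  -- As `X0` is orthogonal to both null vectors, it is a multiple of their cross product.
  have hk : ∃ k : ℝ, e.X0 = k • cross N₁ N₂ := by
    have h3 : cross (cross N₁ N₂) e.X0 = 0 := by rw [cross_cross, h1, h2]; simp
    have h4 := cross_cross (cross N₁ N₂) e.X0 (cross N₁ N₂)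
    rw [h3, hw] at h4
    refine ⟨(B N₁ N₂ ^ 2)⁻¹ * B e.X0 (cross N₁ N₂), ?_⟩
    have h5 : cross 0 (cross N₁ N₂) = 0 := by ext i; fin_cases i <;> simp [cross]
    rw [h5] at h4
    rw [mul_smul, sub_eq_zero.1 h4.symm, smul_smul,
      inv_mul_cancel₀ (pow_ne_zero 2 hneg.ne), one_smul]
  obtain ⟨k, hk⟩ := hk
  have hunit := e.unit_X0
  rw [hk, B_smul_left, B_smul_right, hw] at hunit
  have hor := e.oriented
  rw [h.attracting_unique hp, h.repelling_unique hp, hk, det3_smul_left, det3_smul_middle,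
    det3_smul_right, det3_cycle, ← B_cross, cross_comm,
    show -cross N₁ N₂ = (-1 : ℝ) • cross N₁ N₂ by simp, B_smul_left, hw] at hor
  have hq1 : 0 < e.Xm 2 / N₂ 2 := div_pos e.future_Xm h.future₂
  have hq2 : 0 < e.Xp 2 / N₁ 2 := div_pos e.future_Xp h.future₁
  have hkneg : k < 0 := by
    by_contra! hk0
    have : 0 ≤ k * (e.Xm 2 / N₂ 2 * (e.Xp 2 / N₁ 2 * B N₁ N₂ ^ 2)) := by positivity
    linarith
  have h6 : k * B N₁ N₂ = 1 := by
    have h7 : (k * B N₁ N₂) ^ 2 = 1 := by linear_combination hunit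
    have h8 : 0 < k * B N₁ N₂ := mul_pos_of_neg_of_neg hkneg hneg
    nlinarith
  rw [hk, eq_inv_of_mul_eq_one_left h6]

lemma isHyperbolic (h : IsAxisPair g N₁ N₂ c) : IsHyperbolic g := by
  have hneg := h.B_neg
  have hw : B (cross N₁ N₂) (cross N₁ N₂) = B N₁ N₂ ^ 2 := by
    rw [B_cross_cross, h.null₁, B_comm]; ring
  have s2 : 0 < √2 := by positivity
  have h1 := h.future₁
  have h2 := h.future₂
  have hlen : ∀ N : V, B N N = 0 → 0 < N 2 →
      ((√2 * N 2)⁻¹ • N) 0 ^ 2 + ((√2 * N 2)⁻¹ • N) 1 ^ 2 + ((√2 * N 2)⁻¹ • N) 2 ^ 2 = 1 := by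
    intro N hN hN2
    simp only [B] at hN
    simp only [Pi.smul_apply, smul_eq_mul, mul_pow, inv_pow, Real.sq_sqrt two_pos.le]
    field_simp
    linarith
  refine ⟨⟨c⁻¹, (√2 * N₂ 2)⁻¹ • N₂, (B N₁ N₂)⁻¹ • cross N₁ N₂, (√2 * N₁ 2)⁻¹ • N₁,
    inv_pos.2 h.pos, inv_lt_one_of_one_lt₀ h.one_lt, ?_, ?_, ?_, ?_, ?_, ?_, ?_, ?_, ?_, ?_, ?_⟩⟩
  · rw [act_smul, h.act₂, smul_comm]
  · rw [act_smul, ← cross_act, h.act₁, h.act₂, cross_smul_left, cross_comm, cross_smul_left,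
      cross_comm N₂, ← smul_neg, neg_neg, smul_smul c, mul_inv_cancel₀ h.pos.ne', one_smul]
  · rw [act_smul, h.act₁, inv_inv, smul_comm]
  · rw [B_smul_left, B_smul_right, h.null₂]; simp
  · rw [B_smul_left, B_smul_right, h.null₁]; simp
  · rw [B_smul_left, B_smul_right, hw]
    have := hneg.ne
    field_simp
  · exact hlen _ h.null₂ h2
  · exact hlen _ h.null₁ h1
  · simp only [Pi.smul_apply, smul_eq_mul]; positivity
  · simp only [Pi.smul_apply, smul_eq_mul]; positivity
  · rw [det3_smul_left, det3_smul_middle, det3_smul_right, det3_cycle, ← B_cross, cross_comm,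
      show -cross N₁ N₂ = (-1 : ℝ) • cross N₁ N₂ by simp, B_smul_left, hw]
    have : (B N₁ N₂)⁻¹ * ((√2 * N₂ 2)⁻¹ * ((√2 * N₁ 2)⁻¹ * (-1 * B N₁ N₂ ^ 2))) =
        (√2 * N₂ 2)⁻¹ * (√2 * N₁ 2)⁻¹ * (-B N₁ N₂) := by
      field_simp
    rw [this]
    have := neg_pos.2 hneg
    positivity

lemma neutral_eq (h : IsAxisPair g N₁ N₂ c) : neutral g = (B N₁ N₂)⁻¹ • cross N₁ N₂ := by
  rw [neutral, dif_pos h.isHyperbolic]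
  exact h.eq_of_eigenFrame _

lemma neutral_conj (h : IsAxisPair g N₁ N₂ c) (k : SO21) :
    neutral (k * g * k⁻¹) = act k (neutral g) := by
  rw [(h.conj k).neutral_eq, h.neutral_eq, cross_act, B_act, act_smul]

lemma B_neutral_self (h : IsAxisPair g N₁ N₂ c) : B (neutral g) (neutral g) = 1 := by
  have hneg := h.B_neg
  rw [h.neutral_eq, B_smul_left, B_smul_right, B_cross_cross, h.null₁, B_comm N₂ N₁]
  have := hneg.ne
  field_simp
  ring

lemma B_neutral (h : IsAxisPair g N₁ N₂ c) (x : V) :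
    B (neutral g) x = (B N₁ N₂)⁻¹ * det3 N₁ N₂ x := by
  rw [h.neutral_eq, B_smul_left, B_cross]

lemma cross_neutral₁ (h : IsAxisPair g N₁ N₂ c) : cross (neutral g) N₁ = N₁ := by
  have hneg := h.B_neg
  rw [h.neutral_eq, cross_smul_left, cross_cross, h.null₁, B_comm N₂, zero_smul, sub_zero,
    smul_smul, inv_mul_cancel₀ hneg.ne, one_smul]

lemma cross_neutral₂ (h : IsAxisPair g N₁ N₂ c) : cross (neutral g) N₂ = -N₂ := by
  have hneg := h.B_neg
  rw [h.neutral_eq, cross_smul_left, cross_cross, h.null₂, zero_smul, zero_sub, smul_neg,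
    smul_smul, inv_mul_cancel₀ hneg.ne, one_smul]

lemma mem_axis_iff (h : IsAxisPair g N₁ N₂ c) (x : HypPlane) :
    x ∈ axis g ↔ det3 N₁ N₂ x.1 = 0 := by
  simp only [axis, Set.mem_ofPred_eq, h.isHyperbolic, true_and, B_comm x.1, h.B_neutral]
  simp [h.B_neg.ne]

end IsAxisPair

lemma det3_self_left (x y : V) : det3 x y x = 0 := by simp only [det3_eq]; ring

lemma det3_self_right (x y : V) : det3 x y y = 0 := by simp only [det3_eq]; ring

lemma HypPlane.B_neg (x : HypPlane) {N : V} (hN : IsCausal N) : B x.1 N < 0 := by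
  by_contra! h
  have h1 := x.isCausal.proportional hN h
  have h2 := congrArg (fun y => B y x.1) h1
  simp only [B_smul_left, x.2.1, B_comm N] at h2
  have := mul_nonneg x.2.2.le h
  have := hN.2
  linarith

lemma exists_combination_of_det3_eq_zero {N₁ N₂ : V} (h1 : IsCausal N₁) (h2 : IsCausal N₂)
    (n1 : B N₁ N₁ = 0) (n2 : B N₂ N₂ = 0) (h12 : B N₁ N₂ < 0) (x : HypPlane)
    (hx : det3 N₁ N₂ x.1 = 0) : ∃ α β : ℝ, 0 < α ∧ 0 < β ∧ x.1 = α • N₁ + β • N₂ := by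
  refine ⟨B x.1 N₂ / B N₁ N₂, B x.1 N₁ / B N₁ N₂, div_pos_of_neg_of_neg (x.B_neg h2) h12,
    div_pos_of_neg_of_neg (x.B_neg h1) h12, ?_⟩
  -- Expand `x` in the basis `N₁`, `N₂`, `cross N₁ N₂`; the last coefficient is `det3 N₁ N₂ x`.
  apply ext_of_B
  intro z
  have h4 : B N₁ N₂ ^ 2 * B x.1 z = B N₁ N₂ * (B x.1 N₂ * B N₁ z + B x.1 N₁ * B N₂ z) := by
    have key : (B N₁ N₂ ^ 2 - B N₁ N₁ * B N₂ N₂) * B x.1 z =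
        B N₁ N₂ * (B x.1 N₂ * B N₁ z + B x.1 N₁ * B N₂ z) + det3 N₁ N₂ x.1 * det3 N₁ N₂ z -
          B N₁ N₁ * B x.1 N₂ * B N₂ z - B N₂ N₂ * B x.1 N₁ * B N₁ z := by
      simp only [B, det3_eq]; ring
    rw [n1, n2, hx] at key
    linarith
  rw [B_add_left, B_smul_left, B_smul_left]
  have h5 : B N₁ N₂ ≠ 0 := h12.ne
  have h6 : B N₁ N₂ * B x.1 z = B x.1 N₂ * B N₁ z + B x.1 N₁ * B N₂ z :=
    mul_left_cancel₀ h5 (by linarith)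
  field_simp
  linarith

lemma IsAxisPair.exists_combination {g : SO21} {N₁ N₂ : V} {c : ℝ} (h : IsAxisPair g N₁ N₂ c)
    {x : HypPlane} (hx : x ∈ axis g) : ∃ α β : ℝ, 0 < α ∧ 0 < β ∧ x.1 = α • N₁ + β • N₂ :=
  exists_combination_of_det3_eq_zero h.isCausal₁ h.isCausal₂ h.null₁ h.null₂ h.B_neg x
    ((h.mem_axis_iff x).1 hx)

/-! ### Forward directions and angles -/

lemma cross_add_right (x y z : V) : cross x (y + z) = cross x y + cross x z := by
  ext i; fin_cases i <;> simp [cross] <;> ring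

lemma cross_smul_right (c : ℝ) (x y : V) : cross x (c • y) = c • cross x y := by
  ext i; fin_cases i <;> simp [cross] <;> ring

/-- The forward unit tangent vector of the axis of `g` at `x` is the rotation of the neutral
vector by a right angle: the neutral vector is the unit normal on the left. -/
lemma IsAxisPair.isForwardTangent_iff {g : SO21} {N₁ N₂ : V} {c : ℝ} (h : IsAxisPair g N₁ N₂ c)
    {x : HypPlane} (hx : x ∈ axis g) (v : V) :
    IsForwardTangent g x v ↔ v = cross (neutral g) x.1 := by
  obtain ⟨α, β, hα, hβ, hxe⟩ := h.exists_combination hx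
  have hn := h.B_neutral_self
  have hxn : B (neutral g) x.1 = 0 := by rw [B_comm]; exact hx.2
  have hxx : B x.1 x.1 = -1 := x.2.1
  have hww : B (cross (neutral g) x.1) (cross (neutral g) x.1) = 1 := by
    rw [B_cross_cross, hxn, hn, hxx]; ring
  have hpos : 0 < B (act g x.1) (cross (neutral g) x.1) := by
    have e1 : cross (neutral g) x.1 = α • N₁ - β • N₂ := by
      rw [hxe, cross_add_right, cross_smul_right, cross_smul_right, h.cross_neutral₁,
        h.cross_neutral₂, smul_neg, sub_eq_add_neg]
    rw [e1, hxe, act_add, act_smul, act_smul, h.act₁, h.act₂]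
    simp only [B_add_left, B_sub_right, B_smul_left, B_smul_right, h.null₁, h.null₂, B_comm N₂ N₁]
    have h1 := mul_pos (mul_pos hα hβ) (mul_pos (sub_pos.2 h.inv_lt) (neg_pos.2 h.B_neg))
    linarith
  constructor
  · rintro ⟨h1, h2, h3, h4⟩
    set w := cross (neutral g) x.1 with hw
    have h5 : cross w v = 0 := by
      rw [hw, cross_cross, B_comm x.1, h1, B_comm (neutral g), h2]; simp
    have h6 := cross_cross w v w
    rw [h5, hww, one_smul] at h6
    have h7 : cross 0 w = 0 := by ext i; fin_cases i <;> simp [cross]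
    rw [h7] at h6
    have h8 : v = B v w • w := (sub_eq_zero.1 h6.symm).symm
    obtain ⟨k, hk⟩ : ∃ k, k = B v w := ⟨_, rfl⟩
    rw [← hk] at h8
    rw [h8, B_smul_left, B_smul_right, hww] at h3
    rw [h8, B_smul_right] at h4
    have h9 : 0 < k := by
      by_contra! h
      have := mul_nonneg (neg_nonneg.2 h) hpos.le
      linarith
    have h10 : k = 1 := by nlinarith
    rw [h8, h10, one_smul]
  · rintro rfl
    refine ⟨?_, ?_, hww, hpos⟩
    · rw [B_cross, det3_self_right]
    · rw [B_cross, det3_self_left]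

/-- The angle at a common point of two axes in terms of the neutral vectors; the sign `σ` says
whether the second axis crosses the first one from right to left. -/
lemma exists_leftAngle {h f : SO21} {N₁ N₂ F₁ F₂ : V} {c d : ℝ} (hh : IsAxisPair h N₁ N₂ c)
    (hf : IsAxisPair f F₁ F₂ d) {x : HypPlane} (hxh : x ∈ axis h) (hxf : x ∈ axis f) {σ : ℝ}
    (hσ : σ = 1 ∨ σ = -1) (hpos : 0 < σ * B (neutral h) F₁) :
    ∃ θ, Real.cos θ = σ * B (neutral h) (neutral f) ∧ ∀ y, IsLeftAngle h f x y ↔ y = θ := by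
  obtain ⟨γ, δ, hγ, hδ, hxe⟩ := hf.exists_combination hxf
  have hxn : B (neutral h) x.1 = 0 := by rw [B_comm]; exact hxh.2
  have hxn' : B (neutral f) x.1 = 0 := by rw [B_comm]; exact hxf.2
  have hxx : B x.1 x.1 = -1 := x.2.1
  set s := cross (neutral h) x.1 with hs
  set w := cross (neutral f) x.1 with hw
  have hss : B s s = 1 := by rw [hs, B_cross_cross, hxn, hh.B_neutral_self, hxx]; ring
  have hww : B w w = 1 := by rw [hw, B_cross_cross, hxn', hf.B_neutral_self, hxx]; ring
  have hsw : B s w = B (neutral h) (neutral f) := by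
    rw [hs, hw, B_cross_cross, hxn, hxx]; ring
  have hdet : det3 s w x.1 = 2 * γ * B (neutral h) F₁ := by
    have e1 : det3 s w x.1 = B (neutral h) w := by
      have : det3 (cross (neutral h) x.1) w x.1 = B (neutral h) w * -B x.1 x.1 +
          B (neutral h) x.1 * B w x.1 := by
        simp [det3_eq, cross, B]; ring
      rw [hs, this, hxx, hxn]; ring
    have e2 : w = γ • F₁ - δ • F₂ := by
      rw [hw, hxe, cross_add_right, cross_smul_right, cross_smul_right, hf.cross_neutral₁,
        hf.cross_neutral₂, smul_neg, sub_eq_add_neg]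
    have e3 : w = (2 * γ) • F₁ - x.1 := by
      rw [e2, hxe, two_mul, add_smul]; abel
    rw [e1, e3, B_sub_right, hxn, B_smul_right, sub_zero]
  have hdet' : 0 < det3 s (σ • w) x.1 := by
    rw [det3_smul_middle, hdet]
    have := mul_pos (mul_pos two_pos hγ) hpos
    linarith
  have hgram : det3 s (σ • w) x.1 ^ 2 = 1 - (σ * B s w) ^ 2 := by
    have hxs : B s x.1 = 0 := by rw [hs, B_cross, det3_self_right]
    have hxw : B w x.1 = 0 := by rw [hw, B_cross, det3_self_right]
    have key : det3 s w x.1 ^ 2 = -(B s s * B w w * B x.1 x.1 + 2 * B s w * B w x.1 * B s x.1 -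
        B s s * B w x.1 ^ 2 - B w w * B s x.1 ^ 2 - B x.1 x.1 * B s w ^ 2) := by
      simp only [det3_eq, B]; ring
    have hσ2 : σ ^ 2 = 1 := by rcases hσ with h | h <;> rw [h] <;> norm_num
    rw [hxs, hxw, hss, hww, hxx] at key
    rw [det3_smul_middle, mul_pow, mul_pow, hσ2, key]
    ring
  have hlt : (σ * B s w) ^ 2 < 1 := by
    have := sq_pos_of_pos hdet'
    linarith
  have hlt' := abs_lt.1 ((sq_lt_one_iff_abs_lt_one _).1 hlt)
  refine ⟨Real.arccos (σ * B (neutral h) (neutral f)), ?_, fun y => ⟨?_, ?_⟩⟩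
  · rw [← hsw, Real.cos_arccos hlt'.1.le hlt'.2.le]
  · rintro ⟨s', v, h1, h2, h3, ⟨h4, h5⟩, h6⟩
    rw [hh.isForwardTangent_iff hxh] at h1
    rw [hf.isForwardTangent_iff hxf, hf.isForwardTangent_iff hxf] at h2
    rw [← hs] at h1
    rw [← hw] at h2
    subst h1
    have hv : v = σ • w := by
      have h2' : v = (1 : ℝ) • w ∨ v = (-1 : ℝ) • w := by
        rcases h2 with h | h
        · left; rw [h, one_smul]
        · right; rw [neg_one_smul, ← h, neg_neg]
      rw [det3_smul_middle] at hdet'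
      rcases hσ with rfl | rfl <;> rcases h2' with rfl | rfl
      · rfl
      · rw [det3_smul_middle] at h3; linarith
      · rw [det3_smul_middle] at h3; linarith
      · rfl
    rw [hv, B_smul_right, hsw] at h6
    rw [← h6, Real.arccos_cos h4.le h5.le]
  · rintro rfl
    rw [← hsw]
    refine ⟨s, σ • w, (hh.isForwardTangent_iff hxh _).2 rfl, ?_, hdet', ⟨?_, ?_⟩, ?_⟩
    · rw [hf.isForwardTangent_iff hxf, hf.isForwardTangent_iff hxf]
      rcases hσ with rfl | rfl
      · left; rw [one_smul]
      · right; rw [neg_one_smul, neg_neg]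
    · exact Real.arccos_pos.2 hlt'.2
    · refine lt_of_le_of_ne (Real.arccos_le_pi _) fun h0 => ?_
      have := Real.arccos_eq_pi.1 h0
      linarith
    · rw [Real.cos_arccos hlt'.1.le hlt'.2.le, B_smul_right]

/-- Conjugation moves axes by the conjugating isometry. -/
lemma mem_axis_conj_iff {g : SO21} {N₁ N₂ : V} {c : ℝ} (h : IsAxisPair g N₁ N₂ c) (k : SO21)
    (x : HypPlane) : x ∈ axis (k * g * k⁻¹) ↔ k⁻¹ • x ∈ axis g := by
  rw [h.mem_axis_iff, (h.conj k).mem_axis_iff, ← det3_act k⁻¹, act_inv_act, act_inv_act]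
  rfl

lemma isForwardTangent_conj {g : SO21} {N₁ N₂ : V} {c : ℝ} (h : IsAxisPair g N₁ N₂ c)
    (k : SO21) {x : HypPlane} {v : V} (hv : IsForwardTangent g x v) :
    IsForwardTangent (k * g * k⁻¹) (k • x) (act k v) := by
  obtain ⟨h1, h2, h3, h4⟩ := hv
  have e : (k • x).1 = act k x.1 := rfl
  refine ⟨?_, ?_, ?_, ?_⟩
  · rw [e, B_act, h1]
  · rw [h.neutral_conj, B_act, h2]
  · rw [B_act, h3]
  · rw [e, act_mul, act_mul, act_inv_act, B_act]; exact h4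

lemma isLeftAngle_conj {h f : SO21} {N₁ N₂ F₁ F₂ : V} {c d : ℝ} (hh : IsAxisPair h N₁ N₂ c)
    (hf : IsAxisPair f F₁ F₂ d) (k : SO21) {x : HypPlane} {θ : ℝ} (hθ : IsLeftAngle h f x θ) :
    IsLeftAngle (k * h * k⁻¹) (k * f * k⁻¹) (k • x) θ := by
  obtain ⟨s, v, h1, h2, h3, h4, h5⟩ := hθ
  refine ⟨act k s, act k v, isForwardTangent_conj hh k h1, ?_, ?_, h4, by rw [B_act]; exact h5⟩
  · refine h2.imp (isForwardTangent_conj hf k) fun h => ?_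
    have := isForwardTangent_conj hf k h
    rwa [act, Matrix.mulVec_neg] at this
  · change 0 < det3 (act k s) (act k v) (act k x.1)
    rwa [det3_act]

/-! ### Schottky position and ping-pong -/

variable {b : ℕ}

/-- The inverse of a letter of a word in the free generators. -/
def invLetter (L : Fin b × Bool) : Fin b × Bool := (L.1, !L.2)

/-- The holonomy in Schottky position. The letters are the generators `(i, true)` and their inverses
`(i, false)`; the letter `L` maps the exterior of the half-plane over the arc `(lo, hi)` of the
inverse letter onto the half-plane over the arc of `L`. -/
structure IsSchottky (ρ : Pi1 b →* SO21) (lo hi : Fin b × Bool → ℝ) : Prop where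
  lt : ∀ L, lo L < hi L
  lt_same : ∀ i, hi (i, true) < lo (i, false)
  lt_next : ∀ i j, i < j → hi (i, false) < lo (j, true)
  lt_two_pi : ∀ L L', hi L < lo L' + 2 * Real.pi
  glue : ∀ L, ∃ k : ℝ, 0 < k ∧ ∀ x, side (lo L) (hi L) (act (ρ (FreeGroup.mk [L])) x) =
    -k * side (lo (invLetter L)) (hi (invLetter L)) x

lemma IsHolonomy.exists_isSchottky {ρ : Pi1 b →* SO21} (hρ : IsHolonomy ρ) :
    ∃ lo hi, IsSchottky ρ lo hi := by
  obtain ⟨p, q, r, s, h1, h2, h3, h4⟩ := hρ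
  have hps : ∀ i j, p i < p j + 2 * Real.pi ∧ q i < p j + 2 * Real.pi ∧
      r i < p j + 2 * Real.pi := fun i j =>
    ⟨by linarith [h1 i, h3 i j], by linarith [h1 i, h3 i j], by linarith [h1 i, h3 i j]⟩
  have hg : ∀ i, ∃ k : ℝ, 0 < k ∧ ∀ x, side (p i) (q i) (act (ρ (FreeGroup.of i)) x) =
      -k * side (r i) (s i) x := by
    intro i
    obtain ⟨⟨c, hc, hr⟩, d, hd, hs⟩ := h4 i
    refine ⟨(c * d)⁻¹, by positivity, fun x => ?_⟩
    rw [side, side, ← det3_act (ρ (FreeGroup.of i)) (idealPoint (r i)), hr, hs, det3_smul_left,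
      det3_smul_middle, det3_swap (idealPoint (q i))]
    field_simp
  refine ⟨fun L => if L.2 then p L.1 else r L.1, fun L => if L.2 then q L.1 else s L.1, ?_, ?_, ?_,
    ?_, ?_⟩
  · rintro ⟨i, _ | _⟩
    · exact (h1 i).2.2
    · exact (h1 i).1
  · exact fun i => (h1 i).2.1
  · exact fun i j hij => h2 i j hij
  · rintro ⟨i, _ | _⟩ ⟨j, _ | _⟩ <;> simp <;> linarith [h1 i, h1 j, h3 i j]
  · rintro ⟨i, _ | _⟩
    · obtain ⟨k, hk, h⟩ := hg i
      refine ⟨k⁻¹, inv_pos.2 hk, fun x => ?_⟩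
      have e : (FreeGroup.mk [(i, false)] : Pi1 b) = (FreeGroup.of i)⁻¹ := rfl
      have h5 := h (act (ρ (FreeGroup.of i))⁻¹ x)
      rw [act_act_inv] at h5
      simp only [invLetter, e, map_inv, Bool.not_false, if_true, Bool.false_eq_true, if_false, h5]
      field_simp
    · obtain ⟨k, hk, h⟩ := hg i
      exact ⟨k, hk, h⟩

/-- The half-plane of a letter; the boundary geodesic is included for the generators, and excluded
for their inverses, so that the exterior of all the half-planes is a strict fundamental domain of
its orbit. -/
def InHalfPlane (lo hi : Fin b × Bool → ℝ) (L : Fin b × Bool) (x : V) : Prop :=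
  if L.2 then side (lo L) (hi L) x ≤ 0 else side (lo L) (hi L) x < 0

/-- The exterior of all the half-planes. -/
def InDomain (lo hi : Fin b × Bool → ℝ) (x : V) : Prop :=
  ∀ L, ¬ InHalfPlane lo hi L x

lemma InHalfPlane.side_nonpos {lo hi : Fin b × Bool → ℝ} {L : Fin b × Bool} {x : V}
    (h : InHalfPlane lo hi L x) : side (lo L) (hi L) x ≤ 0 := by
  unfold InHalfPlane at h
  split_ifs at h
  · exact h
  · exact h.le

lemma not_inHalfPlane_of_pos {lo hi : Fin b × Bool → ℝ} {L : Fin b × Bool} {x : V}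
    (h : 0 < side (lo L) (hi L) x) : ¬ InHalfPlane lo hi L x :=
  fun h' => absurd h'.side_nonpos (not_le.2 h)

namespace IsSchottky

variable {ρ : Pi1 b →* SO21} {lo hi : Fin b × Bool → ℝ}

lemma disjoint (S : IsSchottky ρ lo hi) {L L' : Fin b × Bool} (h : L ≠ L') :
    (hi L < lo L' ∧ hi L' < lo L + 2 * Real.pi) ∨
      (hi L' < lo L ∧ hi L < lo L' + 2 * Real.pi) := by
  have h1 := S.lt_two_pi L L'
  have h2 := S.lt_two_pi L' L
  suffices hi L < lo L' ∨ hi L' < lo L from this.imp (fun h => ⟨h, h2⟩) fun h => ⟨h, h1⟩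
  obtain ⟨i, β⟩ := L
  obtain ⟨j, β'⟩ := L'
  have a1 := S.lt_same i
  have a2 := S.lt_same j
  have a3 := S.lt (i, true)
  have a4 := S.lt (i, false)
  have a5 := S.lt (j, true)
  have a6 := S.lt (j, false)
  rcases lt_trichotomy i j with hij | rfl | hij
  · left
    have := S.lt_next i j hij
    cases β <;> cases β' <;> linarith
  · cases β <;> cases β'
    · exact absurd rfl h
    · exact Or.inr a1
    · exact Or.inl a1
    · exact absurd rfl h
  · right
    have := S.lt_next j i hij
    cases β <;> cases β' <;> linarith

lemma side_pos (S : IsSchottky ρ lo hi) {L L' : Fin b × Bool} (h : L ≠ L') {x : V}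
    (hx : IsCausal x) (hs : side (lo L) (hi L) x ≤ 0) : 0 < side (lo L') (hi L') x :=
  side_pos_of_disjoint (S.lt L) (S.lt L') (S.disjoint h) hx hs

lemma inHalfPlane_act_iff (S : IsSchottky ρ lo hi) (L : Fin b × Bool) (x : V) :
    InHalfPlane lo hi L (act (ρ (FreeGroup.mk [L])) x) ↔
      ¬ InHalfPlane lo hi (invLetter L) x := by
  obtain ⟨k, hk, h⟩ := S.glue L
  obtain ⟨i, _ | _⟩ := L
  · simp only [InHalfPlane, h, invLetter]
    simp [hk]
  · simp only [InHalfPlane, h, invLetter]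
    simp [hk]

lemma ping_pong (S : IsSchottky ρ lo hi) {x : V} (hx : IsCausal x) (hD : InDomain lo hi x) :
    ∀ (l : List (Fin b × Bool)) (L : Fin b × Bool), FreeGroup.IsReduced (L :: l) →
      InHalfPlane lo hi L (act (ρ (FreeGroup.mk (L :: l))) x) := by
  intro l
  induction l with
  | nil => exact fun L _ => (S.inHalfPlane_act_iff L x).2 (hD _)
  | cons L' l ih =>
    intro L hred
    have e : (FreeGroup.mk (L :: L' :: l) : Pi1 b) =
      FreeGroup.mk [L] * FreeGroup.mk (L' :: l) := by simp [FreeGroup.mul_mk]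
    rw [e, map_mul, act_mul, S.inHalfPlane_act_iff]
    rw [FreeGroup.isReduced_cons_cons] at hred
    refine not_inHalfPlane_of_pos (S.side_pos ?_ (isCausal_act _ hx) (ih L' hred.2).side_nonpos)
    rintro rfl
    have := hred.1 rfl
    simp [invLetter] at this

lemma eq_one_of_inDomain (S : IsSchottky ρ lo hi) {x : V} (hx : IsCausal x)
    (hD : InDomain lo hi x) {γ : Pi1 b} (hγ : InDomain lo hi (act (ρ γ) x)) : γ = 1 := by
  rw [← FreeGroup.toWord_eq_nil_iff]
  have hred : FreeGroup.IsReduced γ.toWord := FreeGroup.isReduced_toWord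
  have hmk : FreeGroup.mk γ.toWord = γ := FreeGroup.mk_toWord
  rcases h : γ.toWord with _ | ⟨L, l⟩
  · rfl
  · rw [h] at hred hmk
    have := S.ping_pong hx hD l L hred
    rw [hmk] at this
    exact absurd this (hγ L)

end IsSchottky

/-! ### Axes of positive words -/

/-- The positive word `g_{i n} g_{i (n + 1)} ⋯ g_{i (n + k - 1)}`. -/
def posWord (i : ℕ → Fin b) : ℕ → ℕ → Pi1 b
  | _, 0 => 1
  | n, k + 1 => FreeGroup.of (i n) * posWord i (n + 1) k

lemma posWord_add (i : ℕ → Fin b) (n k l : ℕ) :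
    posWord i n (k + l) = posWord i n k * posWord i (n + k) l := by
  induction k generalizing n with
  | zero => simp [posWord]
  | succ k ih =>
    rw [show k + 1 + l = (k + l) + 1 by ring, posWord, posWord, ih, mul_assoc,
      show n + 1 + k = n + (k + 1) by ring]

lemma posWord_congr {i j : ℕ → Fin b} (k n m : ℕ) (h : ∀ t < k, i (n + t) = j (m + t)) :
    posWord i n k = posWord j m k := by
  induction k generalizing n m with
  | zero => rfl
  | succ k ih =>
    rw [posWord, posWord, show i n = j m from h 0 (by omega), ih (n + 1) (m + 1)]
    intro t ht
    have := h (t + 1) (by omega)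
    rwa [show n + (t + 1) = n + 1 + t by ring, show m + (t + 1) = m + 1 + t by ring] at this

lemma IsCausal.combination {x y : V} (hx : IsCausal x) (hy : IsCausal y) {s t : ℝ} (hs : 0 < s)
    (ht : 0 < t) : IsCausal (s • x + t • y) := by
  constructor
  · rw [B_add_left, B_comm _ (s • x + t • y), B_comm _ (s • x + t • y)]
    simp only [B_add_left, B_smul_left, B_smul_right, B_comm y x]
    have h1 := mul_nonneg (mul_pos hs hs).le (neg_nonneg.2 hx.1)
    have h2 := mul_nonneg (mul_pos ht ht).le (neg_nonneg.2 hy.1)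
    have h3 := mul_nonneg (mul_pos hs ht).le (neg_nonneg.2 (hx.B_le hy))
    linarith
  · have h1 := mul_pos hs hx.2
    have h2 := mul_pos ht hy.2
    simp only [Pi.add_apply, Pi.smul_apply, smul_eq_mul]
    linarith

lemma side_idealPoint_nonpos {a b c : ℝ} (h : c ∈ Set.Icc a b) (hb : b < a + 2 * Real.pi) :
    side a b (idealPoint c) ≤ 0 := by
  rcases h.1.eq_or_lt with h1 | h1
  · rw [← h1, side, det3_self_left]
  · rcases h.2.eq_or_lt with h2 | h2
    · rw [h2, side, det3_self_right]
    · exact (side_idealPoint_neg h1 h2 hb).le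

namespace IsAxisPair

variable {g : SO21} {N₁ N₂ : V} {c : ℝ}

lemma act_pow (h : IsAxisPair g N₁ N₂ c) (n : ℕ) (α β : ℝ) :
    act (g ^ n) (α • N₁ + β • N₂) = (c ^ n * α) • N₁ + (c⁻¹ ^ n * β) • N₂ := by
  induction n with
  | zero => simp [act_one]
  | succ n ih =>
    rw [pow_succ', act_mul, ih, act_add, act_smul, act_smul, h.act₁, h.act₂, smul_smul, smul_smul]
    congr 2 <;> ring

/-- Iterating `g` moves a point of its axis to the side of the attracting fixed point. -/
lemma exists_pow_side_pos (h : IsAxisPair g N₁ N₂ c) {x : HypPlane} (hx : x ∈ axis g) {a b : ℝ}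
    (h1 : 0 < side a b N₁) : ∃ n : ℕ, 0 < side a b (act (g ^ n) x.1) := by
  obtain ⟨α, β, hα, hβ, hxe⟩ := h.exists_combination hx
  obtain ⟨n, hn⟩ := pow_unbounded_of_one_lt (β * |side a b N₂| / (α * side a b N₁)) h.one_lt
  refine ⟨n, ?_⟩
  rw [div_lt_iff₀ (by positivity)] at hn
  rw [hxe, h.act_pow, side_add, side_smul, side_smul]
  have h2 : c⁻¹ ^ n ≤ 1 := pow_le_one₀ (inv_nonneg.2 h.pos.le) (inv_lt_one_of_one_lt₀ h.one_lt).le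
  have h3 : 0 ≤ c⁻¹ ^ n := pow_nonneg (inv_nonneg.2 h.pos.le) n
  have h4 : -(β * |side a b N₂|) ≤ c⁻¹ ^ n * β * side a b N₂ := by
    have h5 := neg_abs_le (side a b N₂)
    have h6 : 0 ≤ c⁻¹ ^ n * β := by positivity
    have h7 := mul_le_mul_of_nonneg_left h5 h6
    have h8 : c⁻¹ ^ n * (β * |side a b N₂|) ≤ 1 * (β * |side a b N₂|) :=
      mul_le_mul_of_nonneg_right h2 (by positivity)
    linarith
  linarith

lemma smul_mem_axis (h : IsAxisPair g N₁ N₂ c) {k : SO21} (hk : k * g * k⁻¹ = g) {x : HypPlane}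
    (hx : x ∈ axis g) : k • x ∈ axis g := by
  rw [← hk, mem_axis_conj_iff h, inv_smul_smul]
  exact hx

lemma mem_axis_inv_iff (h : IsAxisPair g N₁ N₂ c) (x : HypPlane) :
    x ∈ axis g⁻¹ ↔ x ∈ axis g := by
  rw [h.mem_axis_iff, h.inv.mem_axis_iff, det3_swap, neg_eq_zero]

end IsAxisPair

namespace IsSchottky

variable {ρ : Pi1 b →* SO21} {lo hi : Fin b × Bool → ℝ} {i : ℕ → Fin b}

lemma posWord_maps (S : IsSchottky ρ lo hi) (k : ℕ) : ∀ (n : ℕ) (x : V), IsCausal x →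
    (0 ≤ side (lo (i (n + k), false)) (hi (i (n + k), false)) x →
      side (lo (i n, true)) (hi (i n, true)) (act (ρ (posWord i n (k + 1))) x) ≤ 0) ∧
    (0 < side (lo (i (n + k), false)) (hi (i (n + k), false)) x →
      side (lo (i n, true)) (hi (i n, true)) (act (ρ (posWord i n (k + 1))) x) < 0) := by
  have hg : ∀ n, ∃ k : ℝ, 0 < k ∧ ∀ x, side (lo (i n, true)) (hi (i n, true))
      (act (ρ (FreeGroup.of (i n))) x) = -k * side (lo (i n, false)) (hi (i n, false)) x :=
    fun n => S.glue (i n, true)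
  induction k with
  | zero =>
    intro n x _
    obtain ⟨k, hk, h⟩ := hg n
    rw [show posWord i n (0 + 1) = FreeGroup.of (i n) from mul_one _, h, add_zero]
    exact ⟨fun h0 => by have := mul_nonneg hk.le h0; linarith,
      fun h0 => by have := mul_pos hk h0; linarith⟩
  | succ k ih =>
    intro n x hx
    obtain ⟨d, hd, h⟩ := hg n
    rw [posWord, map_mul, act_mul, h, show n + (k + 1) = n + 1 + k by ring]
    suffices 0 ≤ side (lo (i (n + 1 + k), false)) (hi (i (n + 1 + k), false)) x →
        0 < side (lo (i n, false)) (hi (i n, false)) (act (ρ (posWord i (n + 1) (k + 1))) x) from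
      ⟨fun h0 => by have := mul_pos hd (this h0); linarith,
        fun h0 => by have := mul_pos hd (this h0.le); linarith⟩
    intro h0
    exact S.side_pos (by simp) (isCausal_act _ hx) ((ih (n + 1) x hx).1 h0)

lemma side_nonpos (S : IsSchottky ρ lo hi) {L : Fin b × Bool} {u : ℝ}
    (hu : u ∈ Set.Icc (lo L) (hi L)) : side (lo L) (hi L) (idealPoint u) ≤ 0 :=
  side_idealPoint_nonpos hu (S.lt_two_pi L L)

/-- A positive word is hyperbolic, with its attracting fixed point in the arc of its first letter
and its repelling fixed point in the arc of the inverse of its last letter. -/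
lemma exists_axisPair (S : IsSchottky ρ lo hi) (i : ℕ → Fin b) (n k : ℕ) : ∃ u w c : ℝ,
    u ∈ Set.Icc (lo (i n, true)) (hi (i n, true)) ∧
    w ∈ Set.Icc (lo (i (n + k), false)) (hi (i (n + k), false)) ∧
    IsAxisPair (ρ (posWord i n (k + 1))) (idealPoint u) (idealPoint w) c := by
  set g := ρ (posWord i n (k + 1)) with hg
  have hne : ((i n, true) : Fin b × Bool) ≠ (i (n + k), false) := by simp
  have hmaps := S.posWord_maps (i := i) k n
  obtain ⟨u, hu, c, hc, hgu⟩ := exists_fixed_idealPoint g (S.lt (i n, true))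
    (S.lt_two_pi _ _) fun φ hφ => (hmaps _ (isCausal_idealPoint φ)).1
      (S.side_pos hne (isCausal_idealPoint φ) (S.side_nonpos hφ)).le
  obtain ⟨w, hw, d, hd, hgw⟩ := exists_fixed_idealPoint g⁻¹ (S.lt (i (n + k), false))
    (S.lt_two_pi _ _) fun φ hφ => by
      by_contra! h
      have h1 := (hmaps _ (isCausal_act g⁻¹ (isCausal_idealPoint φ))).2 h
      rw [← hg, act_act_inv] at h1
      exact absurd (S.side_pos hne (isCausal_idealPoint φ) h1.le)
        (not_lt.2 (S.side_nonpos hφ))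
  have hgw' : act g (idealPoint w) = d⁻¹ • idealPoint w := by
    have h1 := congrArg (act g) hgw
    rw [act_act_inv, act_smul] at h1
    conv_rhs => rw [h1]
    rw [smul_smul, inv_mul_cancel₀ hd.ne', one_smul]
  have h1 := S.side_pos hne (isCausal_idealPoint u) (S.side_nonpos hu)
  have h2 := S.side_nonpos hw
  have hB : B (idealPoint u) (idealPoint w) < 0 := by
    by_contra! h
    have h3 := (isCausal_idealPoint u).proportional (isCausal_idealPoint w) h
    simp only [idealPoint, Matrix.cons_val, one_smul] at h3
    have h4 : idealPoint u = idealPoint w := h3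
    rw [h4] at h1
    linarith
  have hcd : d = c := by
    have h3 := B_act g (idealPoint u) (idealPoint w)
    rw [hgu, hgw', B_smul_left, B_smul_right] at h3
    have h4 : c * d⁻¹ = 1 := mul_right_cancel₀ hB.ne (by linarith)
    field_simp at h4
    exact h4.symm
  subst hcd
  refine ⟨u, w, d, hu, hw, ?_, B_idealPoint u, B_idealPoint w, (isCausal_idealPoint u).2,
    (isCausal_idealPoint w).2, hgu, hgw'⟩
  have h2' : side (lo (i (n + k), false)) (hi (i (n + k), false)) (idealPoint w) < 0 := by
    refine lt_of_le_of_ne h2 fun h0 => ?_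
    have h3 := S.side_pos hne (isCausal_act g (isCausal_idealPoint w))
      ((hmaps _ (isCausal_idealPoint w)).1 h0.ge)
    rw [hgw', side_smul, h0] at h3
    linarith
  -- The point where the axis enters the half-plane of the repelling point is mapped out of it.
  set s₁ := side (lo (i (n + k), false)) (hi (i (n + k), false)) (idealPoint u)
  set s₂ := side (lo (i (n + k), false)) (hi (i (n + k), false)) (idealPoint w)
  have hy := (isCausal_idealPoint u).combination (isCausal_idealPoint w) (neg_pos.2 h2') h1
  have h3 := S.side_pos hne (isCausal_act g hy) ((hmaps _ hy).1 (by
    rw [side_add, side_smul, side_smul]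
    exact le_of_eq (by ring)))
  rw [act_add, act_smul, act_smul, hgu, hgw', side_add, side_smul, side_smul, side_smul,
    side_smul] at h3
  by_contra! h4
  have h5 : 1 ≤ d⁻¹ := (one_le_inv₀ hd).2 h4
  have h6 : 0 ≤ (d⁻¹ - d) * (-s₂ * s₁) :=
    mul_nonneg (by linarith) (mul_nonneg (by linarith) h1.le)
  have h7 : -s₂ * (d * s₁) + s₁ * (d⁻¹ * s₂) = -((d⁻¹ - d) * (-s₂ * s₁)) := by ring
  have h8 : 0 < -s₂ * (d * s₁) + s₁ * (d⁻¹ * s₂) := h3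
  linarith

/-- The axis of an isometry with ideal fixed points in the arcs of `L₁` and `L₂` meets no other
half-plane. -/
lemma side_pos_of_mem_axis (S : IsSchottky ρ lo hi) {g : SO21} {u w c : ℝ} {L₁ L₂ L : Fin b × Bool}
    (hu : u ∈ Set.Icc (lo L₁) (hi L₁)) (hw : w ∈ Set.Icc (lo L₂) (hi L₂))
    (h : IsAxisPair g (idealPoint u) (idealPoint w) c) (h1 : L₁ ≠ L) (h2 : L₂ ≠ L) {x : HypPlane}
    (hx : x ∈ axis g) : 0 < side (lo L) (hi L) x.1 := by
  obtain ⟨α, β, hα, hβ, hxe⟩ := h.exists_combination hx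
  rw [hxe, side_add, side_smul, side_smul]
  have a1 := S.side_pos h1 (isCausal_idealPoint u) (S.side_nonpos hu)
  have a2 := S.side_pos h2 (isCausal_idealPoint w) (S.side_nonpos hw)
  positivity

lemma posWord_conj {k : ℕ} (hi' : ∀ n, i (n + (k + 1)) = i n) (n : ℕ) :
    (posWord i 0 n)⁻¹ * posWord i 0 (k + 1) * posWord i 0 n = posWord i n (k + 1) := by
  have h1 := posWord_add i 0 (k + 1) n
  have h2 := posWord_add i 0 n (k + 1)
  rw [add_comm, h2, posWord_congr (i := i) (j := i) n (0 + (k + 1)) 0 (fun t _ => by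
    rw [zero_add, zero_add, add_comm, hi'])] at h1
  rw [mul_assoc, ← h1, zero_add, inv_mul_cancel_left]

lemma posWord_pow {k : ℕ} (hi' : ∀ n, i (n + (k + 1)) = i n) (M : ℕ) :
    posWord i 0 (M * (k + 1)) = posWord i 0 (k + 1) ^ M := by
  induction M with
  | zero => simp [posWord]
  | succ M ih =>
    rw [add_mul, one_mul, add_comm, posWord_add, pow_succ', ← ih,
      posWord_congr (i := i) (j := i) _ (0 + (k + 1)) 0 (fun t _ => by
        rw [zero_add, zero_add, add_comm, hi'])]

/-- Every point of the axis of a positive word can be moved into the fundamental domain by an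
element that conjugates the word to one of its cyclic permutations. -/
lemma exists_inDomain (S : IsSchottky ρ lo hi) {k : ℕ} (hi' : ∀ n, i (n + (k + 1)) = i n)
    {x : HypPlane} (hx : x ∈ axis (ρ (posWord i 0 (k + 1)))) :
    ∃ (n : ℕ) (γ : Pi1 b), γ⁻¹ * posWord i 0 (k + 1) * γ = posWord i n (k + 1) ∧
      InDomain lo hi ((ρ γ)⁻¹ • x).1 := by
  obtain ⟨u, w, c, hu, hw, hp⟩ := S.exists_axisPair i 0 k
  have hne : ((i 0, true) : Fin b × Bool) ≠ (i (0 + k), false) := by simp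
  obtain ⟨N, hN⟩ := hp.exists_pow_side_pos hx
    (S.side_pos hne (isCausal_idealPoint u) (S.side_nonpos hu))
  set m := posWord i 0 (k + 1) with hm
  obtain ⟨y, hy⟩ : ∃ y, y = (ρ m) ^ N • x := ⟨_, rfl⟩
  have hyax : y ∈ axis (ρ m) := by
    rw [hy]; exact hp.smul_mem_axis (by group) hx
  have hex : ∃ n, 0 < side (lo (i n, true)) (hi (i n, true)) (act (ρ (posWord i 0 n))⁻¹ y.1) := by
    obtain ⟨M, hM⟩ := hp.inv.exists_pow_side_pos ((hp.mem_axis_inv_iff y).2 hyax)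
      (S.side_pos hne.symm (isCausal_idealPoint w) (S.side_nonpos hw))
    refine ⟨M * (k + 1), ?_⟩
    have e : i (M * (k + 1)) = i 0 := by
      clear hM
      induction M with
      | zero => simp
      | succ M ih => rw [add_mul, one_mul, hi', ih]
    rwa [e, posWord_pow hi', map_pow, ← inv_pow]
  classical
  set n := Nat.find hex with hn
  have h1 := Nat.find_spec hex
  rw [← hn] at h1
  refine ⟨n, m⁻¹ ^ N * posWord i 0 n, ?_, ?_⟩
  · rw [← posWord_conj hi', ← hm]
    generalize posWord i 0 n = G
    clear_value m
    group
  have hz : (ρ (m⁻¹ ^ N * posWord i 0 n))⁻¹ • x = (ρ (posWord i 0 n))⁻¹ • y := by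
    rw [hy, smul_smul]
    congr 1
    simp
  rw [hz]
  set z := (ρ (posWord i 0 n))⁻¹ • y with hzdef
  have hzax : z ∈ axis (ρ (posWord i n (k + 1))) := by
    have e : ρ (posWord i n (k + 1)) =
        (ρ (posWord i 0 n))⁻¹ * ρ m * ((ρ (posWord i 0 n))⁻¹)⁻¹ := by
      rw [← posWord_conj hi', map_mul, map_mul, map_inv, inv_inv]
    rw [e, mem_axis_conj_iff hp, hzdef, smul_smul, inv_mul_cancel, one_smul]
    exact hyax
  obtain ⟨u', w', c', hu', hw', hp'⟩ := S.exists_axisPair i n k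
  intro L
  by_cases hL1 : (i n, true) = L
  · rw [← hL1]
    exact not_inHalfPlane_of_pos h1
  by_cases hL2 : (i (n + k), false) = L
  · rw [← hL2]
    suffices 0 ≤ side (lo (i (n + k), false)) (hi (i (n + k), false)) z.1 by
      simpa [InHalfPlane] using this
    rcases hnn : n with _ | n'
    · have e : z.1 = act ((ρ m) ^ N) x.1 := by
        have : z = (ρ m) ^ N • x := by
          rw [hzdef, hnn, posWord, map_one, inv_one, one_smul, hy]
        rw [this]; rfl
      rw [e]
      exact hN.le
    · -- By minimality of `n` the previous point lies in the half-plane of its letter.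
      have h2 := Nat.find_min hex (m := n') (by rw [← hn]; omega)
      rw [not_lt] at h2
      rw [show n' + 1 + k = n' + (k + 1) by ring, hi']
      obtain ⟨d, hd, h3⟩ := S.glue (i n', true)
      have h4 := h3 z.1
      have e : act (ρ (FreeGroup.mk [(i n', true)])) z.1 = act (ρ (posWord i 0 n'))⁻¹ y.1 := by
        change act (ρ (FreeGroup.of (i n'))) (act (ρ (posWord i 0 n))⁻¹ y.1) = _
        rw [hnn, posWord_add, ← act_mul, zero_add,
          show posWord i n' 1 = FreeGroup.of (i n') from mul_one _, map_mul]
        congr 1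
        group
      rw [e] at h4
      rw [h4] at h2
      have h5 : 0 ≤ d * side (lo (i n', false)) (hi (i n', false)) z.1 := by
        have h6 : invLetter ((i n', true) : Fin b × Bool) = (i n', false) := rfl
        rw [h6] at h2
        linarith
      exact (mul_nonneg_iff_of_pos_left hd).1 h5
  · exact not_inHalfPlane_of_pos (S.side_pos_of_mem_axis hu' hw' hp' hL1 hL2 hzax)

end IsSchottky

/-! ### The derivative of the translation length -/

/-- The product of traceless matrices in terms of the Lorentzian products. -/
lemma psiInv_mul (x y : V) : psiInv x * psiInv y = B x y • 1 + psiInv (cross x y) := by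
  ext i j
  fin_cases i <;> fin_cases j <;> simp [psiInv, B, cross, Matrix.mul_apply, Fin.sum_univ_two] <;>
    ring

lemma trace_psiInv (x : V) : (psiInv x).trace = 0 := by
  simp [psiInv, Matrix.trace_fin_two]

lemma psiInv_smul (c : ℝ) (x : V) : psiInv (c • x) = c • psiInv x := by
  ext i j
  fin_cases i <;> fin_cases j <;> simp [psiInv] <;> ring

/-- A lift of a hyperbolic isometry is a combination of the identity and the neutral vector. The two
coefficients have the same sign because the lift stretches the attracting fixed vector. -/
lemma IsAxisPair.exists_lift_eq {g : SO21} {N₁ N₂ : V} {c : ℝ} (h : IsAxisPair g N₁ N₂ c)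
    {A : Matrix.SpecialLinearGroup (Fin 2) ℝ} (hA : IsLift A g) :
    ∃ a β : ℝ, A.1 = a • 1 + β • psiInv (neutral g) ∧ a ^ 2 - β ^ 2 = 1 ∧ 0 < a * β := by
  set n := neutral g with hn
  have hnn : B n n = 1 := h.B_neutral_self
  have hmul : ∀ v, psiInv (act g v) * A.1 = A.1 * psiInv v := by
    intro v
    rw [hA v, Matrix.mul_assoc, ← Matrix.SpecialLinearGroup.coe_mul, inv_mul_cancel]
    simp
  have hdet := A.2
  rw [Matrix.det_fin_two] at hdet
  have hcomm := hmul n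
  rw [hn, act_neutral, ← hn] at hcomm
  have h00 := congrFun (congrFun hcomm 0) 0
  have h01 := congrFun (congrFun hcomm 0) 1
  have h10 := congrFun (congrFun hcomm 1) 0
  simp [psiInv, Matrix.mul_apply, Fin.sum_univ_two] at h00 h01 h10
  simp only [B] at hnn
  -- The traceless part of `A` commutes with the neutral vector, hence is a multiple of it.
  obtain ⟨a, ha⟩ : ∃ a, a = (A.1 0 0 + A.1 1 1) / 2 := ⟨_, rfl⟩
  obtain ⟨β, hβ⟩ : ∃ β, β = (n 0 * (A.1 0 0 - A.1 1 1) + (n 1 - n 2) * A.1 1 0 +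
    (n 1 + n 2) * A.1 0 1) / 2 := ⟨_, rfl⟩
  have e00 : A.1 0 0 = a + β * n 0 := by
    rw [ha, hβ]
    linear_combination (-(A.1 0 0 - A.1 1 1) / 2) * hnn + (-(n 1 + n 2) / 4) * h01 +
      ((n 1 - n 2) / 4) * h10
  have e11 : A.1 1 1 = a - β * n 0 := by
    have : A.1 1 1 = 2 * a - A.1 0 0 := by rw [ha]; ring
    rw [this, e00]; ring
  have e01 : A.1 0 1 = β * (n 1 - n 2) := by
    rw [hβ]
    linear_combination (-A.1 0 1) * hnn + (n 0 / 2) * h01 - ((n 1 - n 2) / 2) * h00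
  have e10 : A.1 1 0 = β * (n 1 + n 2) := by
    rw [hβ]
    linear_combination (-A.1 1 0) * hnn - (n 0 / 2) * h10 + ((n 1 + n 2) / 2) * h00
  have hAeq : A.1 = a • 1 + β • psiInv n := by
    ext i j
    fin_cases i <;> fin_cases j <;> simp [psiInv, e00, e11, e01, e10]
    ring
  have hab : a ^ 2 - β ^ 2 = 1 := by
    rw [e00, e11, e01, e10] at hdet
    linear_combination hdet + β ^ 2 * hnn
  refine ⟨a, β, hAeq, hab, ?_⟩
  -- Compare both sides of `(g N₁) A = A N₁`, using `n N₁ = N₁` and `N₁ n = -N₁`.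
  have h1 := hmul N₁
  have hBn : B n N₁ = 0 := by rw [hn, h.B_neutral, det3_self_left, mul_zero]
  have p1 : psiInv n * psiInv N₁ = psiInv N₁ := by
    rw [psiInv_mul, hBn, zero_smul, zero_add, hn, h.cross_neutral₁]
  have p2 : psiInv N₁ * psiInv n = -psiInv N₁ := by
    rw [psiInv_mul, B_comm, hBn, zero_smul, zero_add, cross_comm, hn, h.cross_neutral₁,
      ← neg_one_smul ℝ N₁, psiInv_smul, neg_one_smul]
  simp only [h.act₁, hAeq, psiInv_smul, Matrix.mul_add, Matrix.add_mul, Matrix.smul_mul,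
    Matrix.mul_smul, p1, p2, Matrix.mul_one, Matrix.one_mul] at h1
  have h2 : c * (a - β) = a + β := by
    have f1 := congrFun (congrFun h1 1) 0
    have f2 := congrFun (congrFun h1 0) 1
    simp [psiInv] at f1 f2
    have := h.future₁
    have : (c * (a - β) - (a + β)) * N₁ 2 = 0 := by linear_combination (f1 - f2) / 2
    have := (mul_eq_zero.1 this).resolve_right h.future₁.ne'
    linarith
  have h3 : (c - 1) * (a - β) ^ 2 = 2 * (β * (a - β)) := by
    linear_combination (a - β) * h2
  have h4 : a - β ≠ 0 := by
    intro h0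
    have : (a - β) * (a + β) = 1 := by linear_combination hab
    rw [h0] at this
    simp at this
  have h5 : 0 < (c - 1) * (a - β) ^ 2 := mul_pos (by linarith [h.one_lt]) (by positivity)
  have h6 : 0 ≤ β ^ 2 := sq_nonneg β
  nlinarith

/-- The translation length in terms of the trace. -/
lemma translationLength_eq (M : Matrix.SpecialLinearGroup (Fin 2) ℝ) (hM : 2 < |M.1.trace|) :
    translationLength M = -2 * Real.log ((|M.1.trace| - √(M.1.trace ^ 2 - 4)) / 2) := by
  obtain ⟨T, hT⟩ : ∃ T, T = M.1.trace := ⟨_, rfl⟩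
  have hroot : ∀ μ : ℝ, M.1.charpoly.IsRoot μ ↔ μ ^ 2 - T * μ + 1 = 0 := by
    intro μ
    rw [Matrix.charpoly_fin_two, Polynomial.IsRoot.def, ← hT, M.2]
    simp
  rw [← hT] at hM ⊢
  have hT2 : T ^ 2 = |T| ^ 2 := (sq_abs T).symm
  have hD : 0 < T ^ 2 - 4 := by rw [hT2]; nlinarith
  have hs := Real.sq_sqrt hD.le
  have hs0 := Real.sqrt_pos.2 hD
  set D := √(T ^ 2 - 4) with hDdef
  have hDT : D < |T| := lt_of_pow_lt_pow_left₀ 2 (abs_nonneg _) (by rw [hs, hT2]; linarith)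
  have hkey : ∀ μ : ℝ, (μ ^ 2 - T * μ + 1 = 0 ∨ (-μ) ^ 2 - T * (-μ) + 1 = 0) → 0 < μ → μ < 1 →
      μ = (|T| - D) / 2 := by
    intro μ h h0 h1
    have h2 : μ ^ 2 - |T| * μ + 1 = 0 := by
      rcases abs_cases T with ⟨ha, hb⟩ | ⟨ha, hb⟩ <;> rcases h with h | h
      · rw [ha]; exact h
      · nlinarith
      · nlinarith
      · rw [ha]; linarith
    have h3 : (2 * μ - |T| - D) * (2 * μ - |T| + D) = 0 := by
      linear_combination 4 * h2 - hs - hT2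
    rcases mul_eq_zero.1 h3 with h4 | h4
    · linarith
    · linarith
  have hex : ∃ μ : ℝ, 0 < μ ∧ μ < 1 ∧ (M.1.charpoly.IsRoot μ ∨ M.1.charpoly.IsRoot (-μ)) := by
    refine ⟨(|T| - D) / 2, by linarith, ?_, ?_⟩
    · nlinarith
    · rw [hroot, hroot]
      rcases abs_cases T with ⟨ha, hb⟩ | ⟨ha, hb⟩
      · left; rw [ha]; linear_combination (1 / 4) * hs
      · right; rw [ha]; linear_combination (1 / 4) * hs
  rw [translationLength, dif_pos hex]
  obtain ⟨h1, h2, h3⟩ := hex.choose_spec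
  rw [hroot, hroot] at h3
  rw [hkey _ h3 h1 h2]

lemma hasDerivAt_length_of_trace {T : ℝ → ℝ} {T' τ : ℝ} (hT : HasDerivAt T T' τ)
    (h2 : 2 < |T τ|) :
    HasDerivAt (fun t => -2 * Real.log ((|T t| - √(T t ^ 2 - 4)) / 2))
      (2 * (SignType.sign (T τ) * T') / √(T τ ^ 2 - 4)) τ := by
  have hne : T τ ≠ 0 := by
    intro h; rw [h, abs_zero] at h2; linarith
  have hT2 : T τ ^ 2 = |T τ| ^ 2 := (sq_abs _).symm
  have hD : 0 < T τ ^ 2 - 4 := by rw [hT2]; nlinarith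
  have hs := Real.sq_sqrt hD.le
  have hs0 := Real.sqrt_pos.2 hD
  have habs : HasDerivAt (fun t => |T t|) (SignType.sign (T τ) * T') τ :=
    (hasDerivAt_abs hne).comp τ hT
  have hsqrt := ((hT.pow 2).sub_const 4).sqrt hD.ne'
  have hDT : √(T τ ^ 2 - 4) < |T τ| :=
    lt_of_pow_lt_pow_left₀ 2 (abs_nonneg _) (by rw [hs, hT2]; linarith)
  have hlog := ((((habs.sub hsqrt).div_const 2).log (by
    simp only [Pi.sub_apply, Pi.pow_apply]
    have := sub_pos.2 hDT
    positivity)).const_mul (-2))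
  refine hlog.congr_deriv ?_
  have hsgn : T τ = SignType.sign (T τ) * |T τ| := (sign_mul_abs _).symm
  have := (sub_pos.2 hDT).ne'
  simp only [Pi.sub_apply, Pi.pow_apply, Nat.cast_ofNat, Nat.add_one_sub_one, pow_one]
  field_simp
  linear_combination T' * hsgn

lemma psiInv_add (x y : V) : psiInv (x + y) = psiInv x + psiInv y := by
  ext i j
  fin_cases i <;> fin_cases j <;> simp [psiInv] <;> ring

open scoped Matrix.Norms.Operator in
lemma hasDerivAt_exp_psiInv {u : V} {R : ℝ → V} (hR : R =O[𝓝 0] (fun t => t ^ 2)) :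
    HasDerivAt (fun t : ℝ => NormedSpace.exp (psiInv (t • u + R t))) (psiInv u) 0 := by
  let ψ : V →ₗ[ℝ] Matrix (Fin 2) (Fin 2) ℝ :=
    { toFun := psiInv, map_add' := psiInv_add, map_smul' := psiInv_smul }
  have hR' : R =O[𝓝 0] (fun t => ‖t - 0‖ ^ 2) := by simpa using hR
  have hR0 : R 0 = 0 := hR'.eq_zero_of_norm_pow two_ne_zero
  have hRd : HasDerivAt R 0 0 := by
    rw [hasDerivAt_iff_isLittleO]
    simpa [hR0] using hR.trans_isLittleO (Asymptotics.isLittleO_pow_id one_lt_two)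
  have hlin : HasDerivAt (fun t : ℝ => t • u + R t) u 0 := by
    have h := ((hasDerivAt_id (0 : ℝ)).smul_const u).add hRd
    rw [one_smul, add_zero] at h
    exact h
  have hψ : HasDerivAt (fun t : ℝ => psiInv (t • u + R t)) (psiInv u) 0 :=
    ψ.toContinuousLinearMap.hasFDerivAt.comp_hasDerivAt (0 : ℝ) hlin
  have h0 : psiInv ((0 : ℝ) • u + R 0) = 0 := by
    rw [hR0, zero_smul, add_zero]; exact ψ.map_zero
  have hexp : HasFDerivAt (NormedSpace.exp : Matrix (Fin 2) (Fin 2) ℝ → Matrix (Fin 2) (Fin 2) ℝ)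
      (1 : Matrix (Fin 2) (Fin 2) ℝ →L[ℝ] Matrix (Fin 2) (Fin 2) ℝ)
      (psiInv ((0 : ℝ) • u + R 0)) := by
    rw [h0]; exact hasFDerivAt_exp_zero
  exact hexp.comp_hasDerivAt (0 : ℝ) hψ

open scoped Matrix.Norms.Operator in
/-- The translation length of a path tangent to `u` changes at twice the rate of the Margulis
invariant. -/
lemma IsAxisPair.hasDerivAt_translationLength {g : SO21} {N₁ N₂ : V} {c : ℝ}
    (h : IsAxisPair g N₁ N₂ c) {M : ℝ → Matrix.SpecialLinearGroup (Fin 2) ℝ}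
    (hM : IsLift (M 0) g) {u : V} {R : ℝ → V} (hR : R =O[𝓝 0] (fun t => t ^ 2))
    (hMR : (∀ᶠ t in 𝓝 (0 : ℝ), (M t).1 = (M 0).1 * NormedSpace.exp (psiInv (t • u + R t))) ∨
      ∀ᶠ t in 𝓝 (0 : ℝ), (M t).1 = NormedSpace.exp (psiInv (t • u + R t)) * (M 0).1) :
    HasDerivAt (fun t => translationLength (M t)) (2 * B u (neutral g)) 0 := by
  obtain ⟨a, β, hA, hab, hpos⟩ := h.exists_lift_eq hM
  have hexp := hasDerivAt_exp_psiInv (u := u) hR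
  let tr : Matrix (Fin 2) (Fin 2) ℝ →L[ℝ] ℝ :=
    (Matrix.traceLinearMap (Fin 2) ℝ ℝ).toContinuousLinearMap
  have htrn : ∀ x y : V, (psiInv x * psiInv y).trace = 2 * B x y := by
    intro x y
    rw [psiInv_mul, Matrix.trace_add, trace_psiInv, Matrix.trace_smul, Matrix.trace_one]
    simp [mul_comm]
  have hval : ((M 0).1 * psiInv u).trace = 2 * β * B u (neutral g) := by
    rw [hA, Matrix.add_mul, Matrix.smul_mul, Matrix.smul_mul, Matrix.one_mul, Matrix.trace_add,
      Matrix.trace_smul, Matrix.trace_smul, trace_psiInv, htrn, B_comm]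
    simp; ring
  have htr : HasDerivAt (fun t => (M t).1.trace) (2 * β * B u (neutral g)) 0 := by
    rw [← hval]
    rcases hMR with hMR | hMR
    · exact (tr.hasFDerivAt.comp_hasDerivAt (0 : ℝ)
        (hexp.const_mul (M 0).1)).congr_of_eventuallyEq
          (hMR.mono fun t ht => congrArg Matrix.trace ht)
    · rw [Matrix.trace_mul_comm]
      exact (tr.hasFDerivAt.comp_hasDerivAt (0 : ℝ)
        (hexp.mul_const (M 0).1)).congr_of_eventuallyEq
          (hMR.mono fun t ht => congrArg Matrix.trace ht)
  have hT0 : (M 0).1.trace = 2 * a := by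
    rw [hA, Matrix.trace_add, Matrix.trace_smul, Matrix.trace_smul, trace_psiInv, Matrix.trace_one]
    simp; ring
  have hβ : β ≠ 0 := by rintro rfl; simp at hpos
  have ha2 : 1 < |a| := by
    rw [← one_lt_sq_iff_one_lt_abs]
    have : 0 < β ^ 2 := by positivity
    linarith
  have h2 : 2 < |(M 0).1.trace| := by
    rw [hT0, abs_mul, abs_two]; linarith
  have hev : ∀ᶠ t in 𝓝 (0 : ℝ), 2 < |(M t).1.trace| :=
    htr.continuousAt.abs.eventually_const_lt h2
  refine ((hasDerivAt_length_of_trace htr h2).congr_of_eventuallyEq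
    (hev.mono fun t ht => translationLength_eq (M t) ht)).congr_deriv ?_
  have hsq : (2 * a) ^ 2 - 4 = (2 * |β|) ^ 2 := by
    rw [mul_pow 2 |β|, sq_abs]; linear_combination 4 * hab
  rw [hT0, hsq, Real.sqrt_sq (by positivity)]
  -- The trace and the coefficient `β` of the neutral vector have the same sign.
  rcases pos_and_pos_or_neg_and_neg_of_mul_pos hpos with ⟨h3, h4⟩ | ⟨h3, h4⟩
  · rw [sign_pos (by linarith), abs_of_pos h4]
    simp
    field_simp
  · rw [sign_neg (by linarith), abs_of_neg h4]
    simp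
    field_simp

/-! ### Crossing and disjoint axes -/

namespace IsAxisPair

variable {g f : SO21} {N₁ N₂ F₁ F₂ : V} {c d : ℝ}

lemma side_pos_of_mem_axis (h : IsAxisPair g N₁ N₂ c) {a b : ℝ} (h1 : 0 < side a b N₁)
    (h2 : 0 < side a b N₂) {x : HypPlane} (hx : x ∈ axis g) : 0 < side a b x.1 := by
  obtain ⟨α, β, hα, hβ, hxe⟩ := h.exists_combination hx
  rw [hxe, side_add, side_smul, side_smul]
  positivity

/-- Axes with linked ideal endpoints cross. -/
lemma exists_mem_inter (hg : IsAxisPair g N₁ N₂ c) (hf : IsAxisPair f F₁ F₂ d)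
    (h1 : 0 < det3 N₁ N₂ F₁) (h2 : det3 N₁ N₂ F₂ < 0) : ∃ x, x ∈ axis g ∧ x ∈ axis f := by
  obtain ⟨s, hs⟩ : ∃ s, s = -det3 N₁ N₂ F₂ := ⟨_, rfl⟩
  obtain ⟨t, ht⟩ : ∃ t, t = det3 N₁ N₂ F₁ := ⟨_, rfl⟩
  have hs0 : 0 < s := by linarith
  have ht0 : 0 < t := by linarith
  obtain ⟨y, hy⟩ : ∃ y, y = s • F₁ + t • F₂ := ⟨_, rfl⟩
  have hyc : IsCausal y := hy ▸ hf.isCausal₁.combination hf.isCausal₂ hs0 ht0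
  have hyy : B y y = 2 * s * t * B F₁ F₂ := by
    rw [hy, B_add_left, B_comm _ (s • F₁ + t • F₂), B_comm _ (s • F₁ + t • F₂)]
    simp only [B_add_left, B_smul_left, B_smul_right, B_comm F₂ F₁, hf.null₁, hf.null₂]
    ring
  have hneg : 0 < -B y y := by
    have := mul_pos (mul_pos hs0 ht0) (neg_pos.2 hf.B_neg)
    rw [hyy]; linarith
  have hr := Real.sqrt_pos.2 hneg
  have hr2 := Real.sq_sqrt hneg.le
  obtain ⟨z, hz⟩ : ∃ z : HypPlane, z.1 = (√(-B y y))⁻¹ • y := by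
    refine ⟨⟨(√(-B y y))⁻¹ • y, ?_, ?_⟩, rfl⟩
    · rw [B_smul_left, B_smul_right, ← mul_assoc, ← mul_inv, ← sq, hr2, inv_neg, neg_mul,
        inv_mul_cancel₀ (by linarith)]
    · simp only [Pi.smul_apply, smul_eq_mul]
      exact mul_pos (inv_pos.2 hr) hyc.2
  refine ⟨z, ?_, ?_⟩
  · rw [hg.mem_axis_iff, hz, det3_smul_right, hy, det3_add_right, det3_smul_right,
      det3_smul_right, hs, ht]
    ring
  · rw [hf.mem_axis_iff, hz, det3_smul_right, hy, det3_add_right, det3_smul_right,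
      det3_smul_right, det3_self_left, det3_self_right]
    ring

/-- Two axes have at most one common point. -/
lemma eq_of_mem_inter (hg : IsAxisPair g N₁ N₂ c) (hf : IsAxisPair f F₁ F₂ d)
    (h1 : det3 N₁ N₂ F₁ ≠ 0) {x y : HypPlane} (hxg : x ∈ axis g) (hxf : x ∈ axis f)
    (hyg : y ∈ axis g) (hyf : y ∈ axis f) : x = y := by
  obtain ⟨s, t, hs, ht, hx⟩ := hf.exists_combination hxf
  obtain ⟨s', t', hs', ht', hy⟩ := hf.exists_combination hyf
  rw [hg.mem_axis_iff] at hxg hyg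
  rw [hx, det3_add_right, det3_smul_right, det3_smul_right] at hxg
  rw [hy, det3_add_right, det3_smul_right, det3_smul_right] at hyg
  have h3 : (s * t' - s' * t) * det3 N₁ N₂ F₁ = 0 := by
    linear_combination t' * hxg - t * hyg
  have h4 := (mul_eq_zero.1 h3).resolve_right h1
  have h5 : x.1 = (s / s') • y.1 := by
    rw [hx, hy, smul_add, smul_smul, smul_smul]
    congr 2
    · field_simp
    · field_simp; linarith
  have h6 := x.2.1
  rw [h5, B_smul_left, B_smul_right, y.2.1] at h6
  have h7 : 0 < s / s' := div_pos hs hs'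
  have h8 : s / s' = 1 := by nlinarith
  rw [h8, one_smul] at h5
  exact Subtype.ext h5

end IsAxisPair

/-! ### The dividing and the crossing curve as positive words -/

/-- The indices of the cyclic word `g_1 ⋯ g_{l+1}`, the inverse of the dividing curve. -/
def dividingIndex {l : ℕ} (hl : l + 1 < b) (n : ℕ) : Fin b :=
  ⟨n % (l + 1), (Nat.mod_lt _ (Nat.succ_pos l)).trans hl⟩

/-- The indices of the cyclic word `g_{l+1} g_{l+2}`, the inverse of the crossing curve. -/
def crossingIndex {l : ℕ} (hl : l + 1 < b) (n : ℕ) : Fin b :=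
  ⟨l + n % 2, by omega⟩

/-- The cyclic permutations of `g_1 ⋯ g_{l+1}`. -/
def dividingWord {l : ℕ} (hl : l + 1 < b) (n : ℕ) : Pi1 b := posWord (dividingIndex hl) n (l + 1)

/-- The cyclic permutations of `g_{l+1} g_{l+2}`. -/
def crossingWord {l : ℕ} (hl : l + 1 < b) (n : ℕ) : Pi1 b := posWord (crossingIndex hl) n 2

section words

variable {l : ℕ} (hl : l + 1 < b)

lemma dividingIndex_add (n : ℕ) : dividingIndex hl (n + (l + 1)) = dividingIndex hl n := by
  simp [dividingIndex]

lemma crossingIndex_add (n : ℕ) : crossingIndex hl (n + (1 + 1)) = crossingIndex hl n := by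
  simp [crossingIndex]

lemma dividingIndex_of_le {n : ℕ} (hn : n ≤ l) : dividingIndex hl n = ⟨n, by omega⟩ := by
  simp [dividingIndex, Nat.mod_eq_of_lt (Nat.lt_succ_of_le hn)]

lemma dividingWord_mod (n : ℕ) : dividingWord hl (n % (l + 1)) = dividingWord hl n :=
  posWord_congr _ _ _ fun t _ => by simp [dividingIndex]

lemma crossingWord_mod (n : ℕ) : crossingWord hl (n % 2) = crossingWord hl n :=
  posWord_congr _ _ _ fun t _ => by simp [crossingIndex]

lemma posWord_one (i : ℕ → Fin b) (n : ℕ) : posWord i n 1 = FreeGroup.of (i n) := mul_one _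

lemma gen_succ {n : ℕ} (hn : n < b) : gen b (n + 1) = FreeGroup.of ⟨n, hn⟩ := by
  rw [gen, dif_pos (by omega)]
  rfl

lemma dividing_eq : dividing b l = (dividingWord hl 0)⁻¹ := by
  have key : ∀ j ≤ l, dividing b j = (posWord (dividingIndex hl) 0 (j + 1))⁻¹ := by
    intro j
    induction j with
    | zero =>
      intro _
      rw [dividing, gen_succ (by omega : 0 < b), posWord, posWord, mul_one,
        dividingIndex_of_le hl (Nat.zero_le l)]
    | succ j ih =>
      intro hj
      rw [dividing, ih (by omega), posWord_add _ 0 (j + 1) 1, mul_inv_rev,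
        gen_succ (by omega : j + 1 < b), posWord_one, zero_add, dividingIndex_of_le hl hj]
  exact key l le_rfl

lemma crossing_eq : crossing b l = (crossingWord hl 0)⁻¹ := by
  rw [crossing, gen_succ hl, gen_succ (by omega : l < b), ← mul_inv_rev]
  simp [crossingWord, posWord, crossingIndex]

lemma dividingWord_conj : dividingWord hl l =
    FreeGroup.of ⟨l, by omega⟩ * dividingWord hl 0 * (FreeGroup.of ⟨l, by omega⟩)⁻¹ := by
  have h1 : dividingWord hl 0 =
      posWord (dividingIndex hl) 0 l * FreeGroup.of ⟨l, by omega⟩ := by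
    rw [dividingWord, posWord_add, zero_add, posWord, posWord, mul_one,
      dividingIndex_of_le hl le_rfl]
  rw [h1, mul_assoc, mul_inv_cancel_right, dividingWord, posWord, dividingIndex_of_le hl le_rfl]
  congr 1
  exact posWord_congr _ _ _ fun t _ => by
    rw [zero_add, add_comm, dividingIndex_add]

lemma crossingWord_zero :
    crossingWord hl 0 = FreeGroup.of ⟨l, by omega⟩ * FreeGroup.of ⟨l + 1, hl⟩ := by
  simp [crossingWord, posWord, crossingIndex]

lemma crossingWord_one :
    crossingWord hl 1 = FreeGroup.of ⟨l + 1, hl⟩ * FreeGroup.of ⟨l, by omega⟩ := by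
  simp [crossingWord, posWord, crossingIndex]

lemma crossingWord_conj : crossingWord hl 0 =
    FreeGroup.of ⟨l, by omega⟩ * crossingWord hl 1 * (FreeGroup.of ⟨l, by omega⟩)⁻¹ := by
  rw [crossingWord_zero, crossingWord_one]; group

lemma crossingWord_conj' : crossingWord hl 1 =
    FreeGroup.of ⟨l + 1, hl⟩ * crossingWord hl 0 * (FreeGroup.of ⟨l + 1, hl⟩)⁻¹ := by
  rw [crossingWord_zero, crossingWord_one]; group

end words

namespace IsSchottky

variable {ρ : Pi1 b →* SO21} {lo hi : Fin b × Bool → ℝ} {l : ℕ}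

lemma angle_lt (S : IsSchottky ρ lo hi) {i j : Fin b} (hij : i < j) {β β' : Bool} {u w : ℝ}
    (hu : u ∈ Set.Icc (lo (i, β)) (hi (i, β))) (hw : w ∈ Set.Icc (lo (j, β')) (hi (j, β'))) :
    u < w := by
  have a1 := S.lt_same i
  have a2 := S.lt_same j
  have a3 := S.lt (i, false)
  have a4 := S.lt (j, true)
  have a5 := S.lt_next i j hij
  have a6 := hu.2
  have a7 := hw.1
  cases β <;> cases β' <;> linarith

lemma angle_lt_same (S : IsSchottky ρ lo hi) {i : Fin b} {u w : ℝ}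
    (hu : u ∈ Set.Icc (lo (i, true)) (hi (i, true)))
    (hw : w ∈ Set.Icc (lo (i, false)) (hi (i, false))) : u < w := by
  have a1 := S.lt_same i
  linarith [hu.2, hw.1]

lemma angle_lt_two_pi (S : IsSchottky ρ lo hi) {L L' : Fin b × Bool} {u w : ℝ}
    (hu : u ∈ Set.Icc (lo L) (hi L)) (hw : w ∈ Set.Icc (lo L') (hi L')) :
    u < w + 2 * Real.pi := by
  linarith [hu.2, hw.1, S.lt_two_pi L L']

/-- The ideal endpoints of the cyclic permutations of the dividing curve. -/
lemma dividingWord_axisPair (S : IsSchottky ρ lo hi) (hl : l + 1 < b) (n : ℕ) : ∃ u w c : ℝ,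
    u ∈ Set.Icc (lo (dividingIndex hl n, true)) (hi (dividingIndex hl n, true)) ∧
    w ∈ Set.Icc (lo (dividingIndex hl (n + l), false)) (hi (dividingIndex hl (n + l), false)) ∧
    IsAxisPair (ρ (dividingWord hl n)) (idealPoint u) (idealPoint w) c :=
  S.exists_axisPair _ _ _

lemma crossingWord_axisPair_zero (S : IsSchottky ρ lo hi) (hl : l + 1 < b) : ∃ u w c : ℝ,
    u ∈ Set.Icc (lo (⟨l, by omega⟩, true)) (hi (⟨l, by omega⟩, true)) ∧
    w ∈ Set.Icc (lo (⟨l + 1, hl⟩, false)) (hi (⟨l + 1, hl⟩, false)) ∧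
    IsAxisPair (ρ (crossingWord hl 0)) (idealPoint u) (idealPoint w) c :=
  S.exists_axisPair (crossingIndex hl) 0 1

lemma crossingWord_axisPair_one (S : IsSchottky ρ lo hi) (hl : l + 1 < b) : ∃ u w c : ℝ,
    u ∈ Set.Icc (lo (⟨l + 1, hl⟩, true)) (hi (⟨l + 1, hl⟩, true)) ∧
    w ∈ Set.Icc (lo (⟨l, by omega⟩, false)) (hi (⟨l, by omega⟩, false)) ∧
    IsAxisPair (ρ (crossingWord hl 1)) (idealPoint u) (idealPoint w) c :=
  S.exists_axisPair (crossingIndex hl) 1 1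

lemma dividingIndex_pred {l : ℕ} (hl : l + 1 < b) {n : ℕ} (h0 : n ≠ 0) (hn : n ≤ l) :
    dividingIndex hl (n + l) = ⟨n - 1, by omega⟩ := by
  rw [show n + l = n - 1 + (l + 1) by omega, dividingIndex_add, dividingIndex_of_le hl (by omega)]

/-- Among the axes of the cyclic permutations of the two curves, only the pairs below can cross. -/
lemma crossing_cases (S : IsSchottky ρ lo hi) (hl : l + 1 < b) {n j : ℕ} (hn : n ≤ l) (hj : j < 2)
    {x : HypPlane} (hx : x ∈ axis (ρ (dividingWord hl n)))
    (hx' : x ∈ axis (ρ (crossingWord hl j))) : n = 0 ∨ (n = l ∧ j = 0) := by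
  by_contra! hcon
  obtain ⟨h0, hcon⟩ := hcon
  obtain ⟨u, w, c, hu, hw, hp⟩ := S.dividingWord_axisPair hl n
  rw [dividingIndex_of_le hl hn] at hu
  rw [dividingIndex_pred hl h0 hn] at hw
  obtain rfl | rfl : j = 0 ∨ j = 1 := by omega
  · have hnl : n < l := lt_of_le_of_ne hn fun h => hcon h rfl
    obtain ⟨u', w', c', hu', hw', hp'⟩ := S.crossingWord_axisPair_zero hl
    have h1 : u' < w' := S.angle_lt (by simp) hu' hw'
    have h2 := hp.side_pos_of_mem_axis (a := u') (b := w')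
      (side_idealPoint_pos' (S.angle_lt (by simpa using hnl) hu hu') h1 (S.angle_lt_two_pi hw' hu))
      (side_idealPoint_pos' (S.angle_lt (by simp; omega) hw hu') h1 (S.angle_lt_two_pi hw' hw)) hx
    have h3 := (hp'.mem_axis_iff x).1 hx'
    exact absurd h3 h2.ne'
  · obtain ⟨u', w', c', hu', hw', hp'⟩ := S.crossingWord_axisPair_one hl
    have h1 : w' < u' := S.angle_lt (by simp) hw' hu'
    have h4 : u < w' := by
      rcases hn.eq_or_lt with rfl | h
      · exact S.angle_lt_same hu hw'
      · exact S.angle_lt (by simpa using h) hu hw'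
    have h2 := hp.side_pos_of_mem_axis (a := w') (b := u')
      (side_idealPoint_pos' h4 h1 (S.angle_lt_two_pi hu' hu))
      (side_idealPoint_pos' (S.angle_lt (by simp; omega) hw hw') h1 (S.angle_lt_two_pi hu' hw)) hx
    have h3 := (hp'.mem_axis_iff x).1 hx'
    rw [side_swap] at h2
    have h5 : side u' w' x.1 = 0 := h3
    linarith

/-- Up to simultaneous conjugation, lifts of the two geodesics cross in only two ways. -/
lemma exists_conj_of_mem_axes (S : IsSchottky ρ lo hi) (hl : l + 1 < b) {x : HypPlane}
    {a c : Pi1 b} (hx : x ∈ axis (ρ (a * dividing b l * a⁻¹)))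
    (hx' : x ∈ axis (ρ (c * crossing b l * c⁻¹))) :
    ∃ k : Pi1 b, k⁻¹ * (a * dividing b l * a⁻¹) * k = (dividingWord hl 0)⁻¹ ∧
      (k⁻¹ * (c * crossing b l * c⁻¹) * k = (crossingWord hl 0)⁻¹ ∨
        k⁻¹ * (c * crossing b l * c⁻¹) * k = (crossingWord hl 1)⁻¹) := by
  have hpd := S.dividingWord_axisPair hl
  obtain ⟨_, _, _, _, _, hp0⟩ := hpd 0
  obtain ⟨_, _, _, _, _, hq0⟩ := S.crossingWord_axisPair_zero hl
  rw [dividing_eq hl, map_mul, map_mul, map_inv, map_inv, mem_axis_conj_iff hp0.inv,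
    hp0.mem_axis_inv_iff] at hx
  rw [crossing_eq hl, map_mul, map_mul, map_inv, map_inv, mem_axis_conj_iff hq0.inv,
    hq0.mem_axis_inv_iff] at hx'
  obtain ⟨n, γ, hγ, hγD⟩ := S.exists_inDomain (dividingIndex_add hl) hx
  obtain ⟨j, δ, hδ, hδD⟩ := S.exists_inDomain (crossingIndex_add hl) hx'
  change γ⁻¹ * dividingWord hl 0 * γ = dividingWord hl n at hγ
  change δ⁻¹ * crossingWord hl 0 * δ = crossingWord hl j at hδ
  have hone : (c * δ)⁻¹ * (a * γ) = 1 := by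
    refine S.eq_one_of_inDomain (HypPlane.isCausal _) hγD ?_
    have e : ρ ((c * δ)⁻¹ * (a * γ)) • (ρ γ)⁻¹ • (ρ a)⁻¹ • x = (ρ δ)⁻¹ • (ρ c)⁻¹ • x := by
      simp only [smul_smul]
      congr 1
      simp [mul_assoc]
    have e' := congrArg Subtype.val e
    change act _ _ = _ at e'
    rw [e']
    exact hδD
  have hk : a * γ = c * δ := (inv_mul_eq_one.1 hone).symm
  -- The common point, moved into the domain, lies on the axes of the permuted words.
  have hz : (ρ γ)⁻¹ • (ρ a)⁻¹ • x ∈ axis (ρ (dividingWord hl n)) := by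
    rw [← hγ, show γ⁻¹ * dividingWord hl 0 * γ = γ⁻¹ * dividingWord hl 0 * γ⁻¹⁻¹ by rw [inv_inv],
      map_mul, map_mul, map_inv ρ γ⁻¹, mem_axis_conj_iff hp0, map_inv, inv_inv, smul_inv_smul]
    exact hx
  have hz' : (ρ γ)⁻¹ • (ρ a)⁻¹ • x ∈ axis (ρ (crossingWord hl j)) := by
    have e : (ρ γ)⁻¹ • (ρ a)⁻¹ • x = (ρ δ)⁻¹ • (ρ c)⁻¹ • x := by
      simp only [smul_smul, ← mul_inv_rev, ← map_mul, hk]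
    rw [e, ← hδ, show δ⁻¹ * crossingWord hl 0 * δ = δ⁻¹ * crossingWord hl 0 * δ⁻¹⁻¹ by
      rw [inv_inv], map_mul, map_mul, map_inv ρ δ⁻¹, mem_axis_conj_iff hq0, map_inv, inv_inv,
      smul_inv_smul]
    exact hx'
  have e1 : (a * γ)⁻¹ * (a * dividing b l * a⁻¹) * (a * γ) = (dividingWord hl n)⁻¹ := by
    rw [← hγ, dividing_eq hl]; group
  have e2 : (a * γ)⁻¹ * (c * crossing b l * c⁻¹) * (a * γ) = (crossingWord hl j)⁻¹ := by
    rw [hk, ← hδ, crossing_eq hl]; group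
  rw [← dividingWord_mod] at e1 hz
  rw [← crossingWord_mod] at e2 hz'
  have hj : j % 2 < 2 := Nat.mod_lt _ two_pos
  rcases S.crossing_cases hl (Nat.lt_succ_iff.1 (Nat.mod_lt _ (Nat.succ_pos l))) hj hz hz' with
    h | ⟨h, h'⟩
  · rw [h] at e1
    refine ⟨a * γ, e1, ?_⟩
    obtain h' | h' : j % 2 = 0 ∨ j % 2 = 1 := by omega
    · left; rw [e2, h']
    · right; rw [e2, h']
  · have hconj : ∀ k g X D : Pi1 b, k⁻¹ * X * k = (g * D * g⁻¹)⁻¹ →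
        (k * g)⁻¹ * X * (k * g) = D⁻¹ := by
      intro k g X D hX
      calc (k * g)⁻¹ * X * (k * g) = g⁻¹ * (k⁻¹ * X * k) * g := by group
        _ = D⁻¹ := by rw [hX]; group
    rw [h, dividingWord_conj hl] at e1
    rw [h', crossingWord_conj hl] at e2
    refine ⟨a * γ * FreeGroup.of ⟨l, by omega⟩, ?_, Or.inr ?_⟩
    · exact hconj _ _ _ _ e1
    · exact hconj _ _ _ _ e2

end IsSchottky

/-! ### The two intersection points on the surface -/

namespace IsAxisPair

/-- An axis whose ideal endpoints lie in a common arc is disjoint from the axis that bounds it. -/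
lemma notMem_axis_of_between {g f : SO21} {u w a d c c' : ℝ}
    (h : IsAxisPair g (idealPoint u) (idealPoint w) c)
    (h' : IsAxisPair f (idealPoint a) (idealPoint d) c') (hu : a < u) (hu' : u < d) (hw : a < w)
    (hw' : w < d) (hd : d < a + 2 * Real.pi) {x : HypPlane} (hx : x ∈ axis g) : x ∉ axis f := by
  intro hxf
  have h1 := side_idealPoint_neg hu hu' hd
  have h2 := side_idealPoint_neg hw hw' hd
  rw [side_swap] at h1 h2
  have h3 := h.side_pos_of_mem_axis (a := d) (b := a) (by linarith) (by linarith) hx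
  have h4 : side a d x.1 = 0 := (h'.mem_axis_iff x).1 hxf
  rw [side_swap] at h3
  linarith

variable {ρ : Pi1 b →* SO21} {X Y : Pi1 b} {N₁ N₂ F₁ F₂ : V} {c d : ℝ}

lemma map_conj (h : IsAxisPair (ρ X) N₁ N₂ c) (a : Pi1 b) :
    IsAxisPair (ρ (a * X * a⁻¹)) (act (ρ a) N₁) (act (ρ a) N₂) c := by
  rw [map_mul, map_mul, map_inv]; exact h.conj _

lemma map_inv' (h : IsAxisPair (ρ X) N₁ N₂ c) : IsAxisPair (ρ X⁻¹) N₂ N₁ c := by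
  rw [map_inv]; exact h.inv

lemma mem_axis_map_inv_iff (h : IsAxisPair (ρ X) N₁ N₂ c) {x : HypPlane} :
    x ∈ axis (ρ X⁻¹) ↔ x ∈ axis (ρ X) := by
  rw [map_inv]; exact h.mem_axis_inv_iff x

lemma map_inv_conj_eq (k X : Pi1 b) :
    ρ (k⁻¹ * X * k) = (ρ k)⁻¹ * ρ X * ((ρ k)⁻¹)⁻¹ := by
  rw [map_mul, map_mul, map_inv, inv_inv]

lemma smul_mem_axis_map (h : IsAxisPair (ρ X) N₁ N₂ c) (k : Pi1 b) {x : HypPlane}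
    (hx : x ∈ axis (ρ X)) : (ρ k)⁻¹ • x ∈ axis (ρ (k⁻¹ * X * k)) := by
  rw [map_inv_conj_eq, mem_axis_conj_iff h, smul_smul, inv_mul_cancel, one_smul]
  exact hx

lemma isLeftAngle_map (h : IsAxisPair (ρ X) N₁ N₂ c) (h' : IsAxisPair (ρ Y) F₁ F₂ d) (k : Pi1 b)
    {x : HypPlane} {θ : ℝ} (hθ : IsLeftAngle (ρ X) (ρ Y) x θ) :
    IsLeftAngle (ρ (k⁻¹ * X * k)) (ρ (k⁻¹ * Y * k)) ((ρ k)⁻¹ • x) θ := by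
  rw [map_inv_conj_eq, map_inv_conj_eq]
  exact isLeftAngle_conj h h' _ hθ

end IsAxisPair

lemma proj_eq_iff {ρ : Pi1 b →* SO21} {x y : HypPlane} :
    proj ρ x = proj ρ y ↔ ∃ γ : Pi1 b, ρ γ • y = x := by
  rw [proj, proj, Quotient.eq]
  constructor
  · rintro ⟨⟨_, γ, rfl⟩, h⟩
    exact ⟨γ, h⟩
  · rintro ⟨γ, h⟩
    exact ⟨⟨ρ γ, γ, rfl⟩, h⟩

namespace IsSchottky

variable {ρ : Pi1 b →* SO21} {lo hi : Fin b × Bool → ℝ} {l : ℕ}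

/-- The two kinds of crossings give different points of the surface. -/
lemma proj_ne_proj (S : IsSchottky ρ lo hi) (hl : l + 1 < b) (hl1 : 1 ≤ l) {x y : HypPlane}
    (hx : x ∈ axis (ρ (dividingWord hl 0))) (hx' : x ∈ axis (ρ (crossingWord hl 0)))
    (hy : y ∈ axis (ρ (dividingWord hl 0))) (hy' : y ∈ axis (ρ (crossingWord hl 1))) :
    proj ρ x ≠ proj ρ y := by
  rw [Ne, proj_eq_iff]
  rintro ⟨γ, hγ⟩
  obtain ⟨u, w, c, hu, hw, hp⟩ := S.dividingWord_axisPair hl 0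
  obtain ⟨u₁, w₁, c₁, hu₁, hw₁, hp₁⟩ := S.dividingWord_axisPair hl l
  obtain ⟨v, z, d, hv, hz, hq⟩ := S.crossingWord_axisPair_zero hl
  obtain ⟨v₁, z₁, d₁, hv₁, hz₁, hq₁⟩ := S.crossingWord_axisPair_one hl
  rw [dividingIndex_of_le hl (Nat.zero_le l)] at hu
  rw [zero_add, dividingIndex_of_le hl le_rfl] at hw
  rw [dividingIndex_of_le hl le_rfl] at hu₁
  rw [dividingIndex_pred hl (by omega) le_rfl] at hw₁
  have hxD : InDomain lo hi x.1 := by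
    intro L
    apply not_inHalfPlane_of_pos
    by_cases h1 : ((⟨l, by omega⟩, true) : Fin b × Bool) = L
    · subst h1
      exact S.side_pos_of_mem_axis hu hw hp (by simp; omega) (by simp) hx
    by_cases h2 : ((⟨l + 1, hl⟩, false) : Fin b × Bool) = L
    · subst h2
      exact S.side_pos_of_mem_axis hu hw hp (by simp) (by simp) hx
    exact S.side_pos_of_mem_axis hv hz hq h1 h2 hx'
  by_cases hin : InHalfPlane lo hi (⟨l, by omega⟩, false) y.1
  · -- Move `y` back into the domain by the generator whose inverse half-plane contains it.
    obtain ⟨y', hyy⟩ : ∃ y', y' = ρ (FreeGroup.of ⟨l, by omega⟩) • y := ⟨_, rfl⟩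
    have hy1 : y' ∈ axis (ρ (dividingWord hl l)) := by
      rw [dividingWord_conj, map_mul, map_mul, map_inv, mem_axis_conj_iff hp, hyy, inv_smul_smul]
      exact hy
    have hy2 : y' ∈ axis (ρ (crossingWord hl 0)) := by
      rw [crossingWord_conj, map_mul, map_mul, map_inv, mem_axis_conj_iff hq₁, hyy, inv_smul_smul]
      exact hy'
    have hyD : InDomain lo hi y'.1 := by
      intro L
      by_cases h1 : ((⟨l, by omega⟩, true) : Fin b × Bool) = L
      · subst h1
        have h3 := (S.inHalfPlane_act_iff (⟨l, by omega⟩, true) y.1).not.2 (not_not.2 hin)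
        rw [hyy]
        exact h3
      apply not_inHalfPlane_of_pos
      by_cases h2 : ((⟨l + 1, hl⟩, false) : Fin b × Bool) = L
      · subst h2
        exact S.side_pos_of_mem_axis hu₁ hw₁ hp₁ (by simp) (by simp) hy1
      exact S.side_pos_of_mem_axis hv hz hq h1 h2 hy2
    have hγ' : ρ (γ * (FreeGroup.of ⟨l, by omega⟩)⁻¹) • y' = x := by
      rw [hyy, smul_smul, ← map_mul, inv_mul_cancel_right]
      exact hγ
    have h1 := S.eq_one_of_inDomain (y'.isCausal) hyD
      (γ := γ * (FreeGroup.of ⟨l, by omega⟩)⁻¹) (by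
        have := congrArg Subtype.val hγ'
        change act _ _ = _ at this
        rw [this]; exact hxD)
    rw [h1, map_one, one_smul] at hγ'
    rw [hγ'] at hy1
    refine hp₁.notMem_axis_of_between hp ?_ ?_ ?_ ?_ ?_ hy1 hx
    · exact S.angle_lt (by simp; omega) hu hu₁
    · exact S.angle_lt_same hu₁ hw
    · rcases hl1.eq_or_lt with rfl | h
      · exact S.angle_lt_same hu hw₁
      · exact S.angle_lt (by simp; omega) hu hw₁
    · exact S.angle_lt (by simp; omega) hw₁ hw
    · exact S.angle_lt_two_pi hw hu
  · have hyD : InDomain lo hi y.1 := by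
      intro L
      by_cases h1 : ((⟨l, by omega⟩, false) : Fin b × Bool) = L
      · subst h1; exact hin
      apply not_inHalfPlane_of_pos
      by_cases h2 : ((⟨l + 1, hl⟩, true) : Fin b × Bool) = L
      · subst h2
        exact S.side_pos_of_mem_axis hu hw hp (by simp) (by simp) hy
      exact S.side_pos_of_mem_axis hv₁ hz₁ hq₁ h2 h1 hy'
    have h1 := S.eq_one_of_inDomain (y.isCausal) hyD (γ := γ) (by
        have := congrArg Subtype.val hγ
        change act _ _ = _ at this
        rw [this]; exact hxD)
    rw [h1, map_one, one_smul] at hγ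
    rw [hγ] at hy'
    refine hq₁.notMem_axis_of_between hq ?_ ?_ ?_ ?_ ?_ hy' hx'
    · exact S.angle_lt (by simp) hv hv₁
    · exact S.angle_lt_same hv₁ hz
    · exact S.angle_lt_same hv hz₁
    · exact S.angle_lt (by simp) hz₁ hz
    · exact S.angle_lt_two_pi hz hv

/-- The ideal endpoints of the two curves in the position in which they cross. For the second
permutation of the crossing curve one endpoint shares an arc with an endpoint of the dividing curve;
their order is found after conjugating by a generator. -/
lemma exists_linked_axisPairs (S : IsSchottky ρ lo hi) (hl : l + 1 < b) (hl1 : 1 ≤ l) :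
    ∃ u w v z v₁ z₁ c d d₁ : ℝ,
      IsAxisPair (ρ (dividingWord hl 0)) (idealPoint u) (idealPoint w) c ∧
      IsAxisPair (ρ (crossingWord hl 0)) (idealPoint v) (idealPoint z) d ∧
      IsAxisPair (ρ (crossingWord hl 1)) (idealPoint v₁) (idealPoint z₁) d₁ ∧
      side u w (idealPoint v) < 0 ∧ 0 < side u w (idealPoint z) ∧
      0 < side u w (idealPoint v₁) ∧ side u w (idealPoint z₁) < 0 := by
  obtain ⟨u, w, c, hu, hw, hp⟩ := S.dividingWord_axisPair hl 0
  obtain ⟨u₁, w₁, c₁, hu₁, hw₁, hp₁⟩ := S.dividingWord_axisPair hl l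
  obtain ⟨v, z, d, hv, hz, hq⟩ := S.crossingWord_axisPair_zero hl
  obtain ⟨v₁, z₁, d₁, hv₁, hz₁, hq₁⟩ := S.crossingWord_axisPair_one hl
  rw [dividingIndex_of_le hl (Nat.zero_le l)] at hu
  rw [zero_add, dividingIndex_of_le hl le_rfl] at hw
  rw [dividingIndex_of_le hl le_rfl] at hu₁
  rw [dividingIndex_pred hl (by omega) le_rfl] at hw₁
  have huw : u < w := S.angle_lt (by simp; omega) hu hw
  refine ⟨u, w, v, z, v₁, z₁, c, d, d₁, hp, hq, hq₁, ?_, ?_, ?_, ?_⟩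
  · exact side_idealPoint_neg (S.angle_lt (by simp; omega) hu hv) (S.angle_lt_same hv hw)
      (S.angle_lt_two_pi hw hu)
  · exact side_idealPoint_pos huw (S.angle_lt (by simp) hw hz) (S.angle_lt_two_pi hz hu)
  · exact side_idealPoint_pos huw (S.angle_lt (by simp) hw hv₁) (S.angle_lt_two_pi hv₁ hu)
  · have hp' := hp.map_conj (FreeGroup.of ⟨l, by omega⟩)
    have hq' := hq₁.map_conj (FreeGroup.of ⟨l, by omega⟩)
    rw [← dividingWord_conj] at hp'
    rw [← crossingWord_conj] at hq'
    rw [side, ← det3_act (ρ (FreeGroup.of ⟨l, by omega⟩)), hp₁.attracting_unique hp',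
      hp₁.repelling_unique hp', hq.repelling_unique hq', det3_smul_left, det3_smul_middle,
      det3_smul_right]
    have h1 := div_pos hp'.future₁ hp₁.future₁
    have h2 := div_pos hp'.future₂ hp₁.future₂
    have h3 := div_pos hq'.future₂ hq.future₂
    refine mul_neg_of_pos_of_neg h1 (mul_neg_of_pos_of_neg h2 (mul_neg_of_pos_of_neg h3 ?_))
    change side u₁ w₁ (idealPoint z) < 0
    rw [side_swap]
    have := side_idealPoint_pos (S.angle_lt (by simp; omega) hw₁ hu₁)
      (S.angle_lt (by simp) hu₁ hz) (S.angle_lt_two_pi hz hw₁)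
    linarith

end IsSchottky

/-! ### Margulis invariants of the affine twists -/

lemma B_sum_left {ι : Type*} (s : Finset ι) (f : ι → V) (y : V) :
    B (∑ k ∈ s, f k) y = ∑ k ∈ s, B (f k) y := by
  classical
  induction s using Finset.induction_on with
  | empty => simp [B_zero_left]
  | insert k s hk ih => rw [Finset.sum_insert hk, Finset.sum_insert hk, B_add_left, ih]

lemma margulis_coboundary (ρ : Pi1 b →* SO21) (v : V) (γ : Pi1 b) :
    B (coboundary ρ v γ) (neutral (ρ γ)) = 0 := by
  have h : B (act (ρ γ) v) (neutral (ρ γ)) = B v (neutral (ρ γ)) := by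
    conv_lhs => rw [← act_neutral (ρ γ), B_act]
  rw [coboundary, B_sub_left, h, sub_self]

lemma affineTwist_crossing_of_lt (ρ : Pi1 b →* SO21) {k l : ℕ} (h : k < l) :
    affineTwist ρ k (crossing b l) =
      coboundary ρ (neutral (ρ (dividing b k))) (crossing b l) := by
  have hc : IsCocycle ρ (affineTwist ρ k) := isCocycle_cocycleOf ρ _
  have hd := isCocycle_coboundary ρ (neutral (ρ (dividing b k)))
  exact hc.eq_mul hd (hc.eq_inv hd (affineTwist_gen_high ρ k _ (by omega)))
    (hc.eq_inv hd (affineTwist_gen_high ρ k _ (by omega)))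

lemma affineTwist_crossing_of_gt (ρ : Pi1 b →* SO21) {k l : ℕ} (h : l < k) :
    affineTwist ρ k (crossing b l) = 0 := by
  have hc : IsCocycle ρ (affineTwist ρ k) := isCocycle_cocycleOf ρ _
  exact hc.eq_mul (isCocycle_zero ρ)
    (hc.eq_inv (isCocycle_zero ρ) (affineTwist_gen_low ρ k _ (by omega)))
    (hc.eq_inv (isCocycle_zero ρ) (affineTwist_gen_low ρ k _ (by omega)))

lemma affineTwist_crossing_self (ρ : Pi1 b →* SO21) (l : ℕ) :
    affineTwist ρ l (crossing b l) = neutral (ρ (dividing b l)) -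
      act (ρ (gen b (l + 2)))⁻¹ (neutral (ρ (dividing b l))) := by
  have hc : IsCocycle ρ (affineTwist ρ l) := isCocycle_cocycleOf ρ _
  have h1 := hc.eq_inv (isCocycle_zero ρ) (affineTwist_gen_low ρ l (l + 1) le_rfl)
  have h2 := hc.eq_inv (isCocycle_coboundary ρ (neutral (ρ (dividing b l))))
    (affineTwist_gen_high ρ l (l + 2) le_rfl)
  rw [crossing, hc, h1, h2, act_zero, zero_add, coboundary, map_inv]

end AffineDeformation

theorem theorem2 (b : ℕ) (hb : 3 ≤ b) (ρ : Pi1 b →* SO21) (hρ : IsHolonomy ρ)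
    (l : ℕ) (hl : 1 ≤ l) (hl' : l ≤ b - 2) :
    ∃ (P Q : Surface ρ) (θ θ' : ℝ),
      P ≠ Q ∧
      closedGeodesic ρ (dividing b l) ∩ closedGeodesic ρ (crossing b l) = {P, Q} ∧
      (∀ x, IsSurfaceAngle ρ (dividing b l) (crossing b l) P x ↔ x = θ) ∧
      (∀ x, IsSurfaceAngle ρ (dividing b l) (crossing b l) Q x ↔ x = θ') ∧
      ∀ (u₀ u : Pi1 b → V) (t : ℕ → ℝ), IsCocycle ρ u₀ →
        (u = fun γ => u₀ γ + ∑ k ∈ Finset.Icc 1 (b - 2), t k • affineTwist ρ k γ) →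
        ∀ ι : ℝ → Pi1 b → Matrix.SpecialLinearGroup (Fin 2) ℝ, IsDeformation ρ u ι →
          ∃ L' : ℝ, HasDerivAt (fun τ => translationLength (ι τ (crossing b l))) L' 0 ∧
            1 / 2 * L' = margulis ρ u₀ (crossing b l) + t l * (Real.cos θ + Real.cos θ') := by
  obtain ⟨lo, hi, S⟩ := hρ.exists_isSchottky
  have hlb : l + 1 < b := by omega
  obtain ⟨u, w, v, z, v₁, z₁, c, d, d₁, hp, hq, hq₁, s1, s2, s3, s4⟩ :=
    S.exists_linked_axisPairs hlb hl
  obtain ⟨x, hx, hx'⟩ := hp.exists_mem_inter hq.inv s2 s1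
  rw [hq.mem_axis_inv_iff] at hx'
  obtain ⟨y, hy, hy'⟩ := hp.exists_mem_inter hq₁ s3 s4
  have hη := dividing_eq hlb
  have hφ := crossing_eq hlb
  set η := dividing b l
  set φ := crossing b l
  set φ' := (crossingWord hlb 1)⁻¹ with hφ'
  -- The second lift of the crossing geodesic is the translate by this element.
  obtain ⟨e, he⟩ : ∃ e : Pi1 b, e = (FreeGroup.of ⟨l, by omega⟩)⁻¹ := ⟨_, rfl⟩
  have heφ : e * φ * e⁻¹ = φ' := by
    rw [hφ, hφ', crossingWord_conj, he]; group
  have hpη : IsAxisPair (ρ η) (idealPoint w) (idealPoint u) c := by rw [hη]; exact hp.map_inv'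
  have hqφ : IsAxisPair (ρ φ) (idealPoint z) (idealPoint v) d := by rw [hφ]; exact hq.map_inv'
  have hqφ' : IsAxisPair (ρ φ') (idealPoint z₁) (idealPoint v₁) d₁ := hq₁.map_inv'
  have hxη : x ∈ axis (ρ η) := by rw [hη]; exact hp.mem_axis_map_inv_iff.2 hx
  have hyη : y ∈ axis (ρ η) := by rw [hη]; exact hp.mem_axis_map_inv_iff.2 hy
  have hxφ : x ∈ axis (ρ φ) := by rw [hφ]; exact hq.mem_axis_map_inv_iff.2 hx'
  have hyφ' : y ∈ axis (ρ φ') := hq₁.mem_axis_map_inv_iff.2 hy'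
  have hne := S.proj_ne_proj hlb hl hx hx' hy hy'
  have hinv := inv_lt_zero.2 hpη.B_neg
  have hsz : 0 < 1 * B (neutral (ρ η)) (idealPoint z) := by
    rw [one_mul, hpη.B_neutral, det3_swap]
    exact mul_pos_of_neg_of_neg hinv (neg_lt_zero.2 s2)
  have hsz₁ : 0 < -1 * B (neutral (ρ η)) (idealPoint z₁) := by
    rw [hpη.B_neutral, det3_swap]
    have := mul_pos_of_neg_of_neg hinv s4
    change 0 < -1 * ((B (idealPoint w) (idealPoint u))⁻¹ * -side u w (idealPoint z₁))
    linarith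
  obtain ⟨θ, hθ, hθ'⟩ := exists_leftAngle hpη hqφ hxη hxφ (Or.inl rfl) hsz
  obtain ⟨ω, hω, hω'⟩ := exists_leftAngle hpη hqφ' hyη hyφ' (Or.inr rfl) hsz₁
  -- Up to the group, a crossing of lifts is one of the two crossings found above.
  have key : ∀ (x' : HypPlane) (a g : Pi1 b), x' ∈ axis (ρ (a * η * a⁻¹)) →
      x' ∈ axis (ρ (g * φ * g⁻¹)) → ∃ k : Pi1 b, k⁻¹ * (a * η * a⁻¹) * k = η ∧
        ((k⁻¹ * (g * φ * g⁻¹) * k = φ ∧ (ρ k)⁻¹ • x' = x) ∨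
          (k⁻¹ * (g * φ * g⁻¹) * k = φ' ∧ (ρ k)⁻¹ • x' = y)) := by
    intro x' a g h1 h2
    obtain ⟨k, hk, hk'⟩ := S.exists_conj_of_mem_axes hlb h1 h2
    rw [← hη] at hk
    rw [← hφ, ← hφ'] at hk'
    have h3 := (hpη.map_conj a).smul_mem_axis_map k h1
    have h4 := (hqφ.map_conj g).smul_mem_axis_map k h2
    rw [hk] at h3
    refine ⟨k, hk, hk'.imp (fun h => ⟨h, ?_⟩) fun h => ⟨h, ?_⟩⟩
    · rw [h] at h4
      refine hpη.eq_of_mem_inter hqφ (fun h0 => ?_) h3 h4 hxη hxφ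
      rw [hpη.B_neutral, h0] at hsz
      simp at hsz
    · rw [h] at h4
      refine hpη.eq_of_mem_inter hqφ' (fun h0 => ?_) h3 h4 hyη hyφ'
      rw [hpη.B_neutral, h0] at hsz₁
      simp at hsz₁
  have hproj : ∀ (k : Pi1 b) (x' y' : HypPlane), (ρ k)⁻¹ • x' = y' → proj ρ x' = proj ρ y' := by
    rintro k x' y' rfl
    exact proj_eq_iff.2 ⟨k, smul_inv_smul _ _⟩
  refine ⟨proj ρ x, proj ρ y, θ, ω, hne, ?_, ?_, ?_, ?_⟩
  · ext p
    constructor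
    · rintro ⟨⟨x', h1, rfl⟩, y', h2, h3⟩
      obtain ⟨g, rfl⟩ := proj_eq_iff.1 h3.symm
      obtain ⟨k, -, hk⟩ := key (ρ g • y') 1 g (by simpa using h1) (by
        rw [map_mul, map_mul, map_inv, mem_axis_conj_iff hqφ, inv_smul_smul]
        exact h2)
      rcases hk with ⟨-, hk⟩ | ⟨-, hk⟩
      · exact Or.inl (hproj k _ _ hk)
      · exact Or.inr (hproj k _ _ hk)
    · rintro (rfl | rfl)
      · exact ⟨⟨x, hxη, rfl⟩, x, hxφ, rfl⟩
      · refine ⟨⟨y, hyη, rfl⟩, (ρ e)⁻¹ • y, ?_, proj_eq_iff.2 ⟨e⁻¹, ?_⟩⟩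
        · have := hyφ'
          rwa [← heφ, map_mul, map_mul, map_inv, mem_axis_conj_iff hqφ] at this
        · rw [map_inv]
  · intro α
    constructor
    · rintro ⟨x', a, g, h1, h2, h3, h4⟩
      obtain ⟨k, hk, hk' | hk'⟩ := key x' a g h2 h3
      · have h5 := (hpη.map_conj a).isLeftAngle_map (hqφ.map_conj g) k h4
        rw [hk, hk'.1, hk'.2] at h5
        exact (hθ' α).1 h5
      · exact absurd (h1.symm.trans (hproj k _ _ hk'.2)) hne
    · intro hα
      refine ⟨x, 1, 1, rfl, ?_, ?_, ?_⟩ <;> simp only [one_mul, inv_one, mul_one]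
      · exact hxη
      · exact hxφ
      · exact (hθ' α).2 hα
  · intro α
    constructor
    · rintro ⟨x', a, g, h1, h2, h3, h4⟩
      obtain ⟨k, hk, hk' | hk'⟩ := key x' a g h2 h3
      · exact absurd ((hproj k _ _ hk'.2).symm.trans h1) hne
      · have h5 := (hpη.map_conj a).isLeftAngle_map (hqφ.map_conj g) k h4
        rw [hk, hk'.1, hk'.2] at h5
        exact (hω' α).1 h5
    · intro hα
      refine ⟨y, 1, e, rfl, ?_, ?_, ?_⟩ <;> simp only [one_mul, inv_one, mul_one, heφ]
      · exact hyη
      · exact hyφ'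
      · exact (hω' α).2 hα
  · intro u₀ u t _ hu ι hι
    refine ⟨2 * B (u φ) (neutral (ρ φ)), ?_, ?_⟩
    · rcases hι.2 with h | h
      · obtain ⟨R, hR, hR'⟩ := h φ
        exact hqφ.hasDerivAt_translationLength (hι.1 φ) hR (Or.inl hR')
      · obtain ⟨R, hR, hR'⟩ := h φ
        exact hqφ.hasDerivAt_translationLength (hι.1 φ) hR (Or.inr hR')
    · have hsum : ∑ k ∈ Finset.Icc 1 (b - 2), B (t k • affineTwist ρ k φ) (neutral (ρ φ)) =
          t l * (Real.cos θ + Real.cos ω) := by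
        rw [Finset.sum_eq_single_of_mem l (Finset.mem_Icc.2 ⟨hl, hl'⟩)]
        · have hn : act (ρ (gen b (l + 2))) (neutral (ρ φ)) = neutral (ρ φ') := by
            have h : FreeGroup.of ⟨l + 1, hlb⟩ * φ * (FreeGroup.of ⟨l + 1, hlb⟩)⁻¹ = φ' := by
              rw [hφ', hφ, crossingWord_conj' hlb]; group
            rw [← hqφ.neutral_conj, gen_succ hlb, ← map_inv, ← map_mul, ← map_mul, h]
          rw [B_smul_left, affineTwist_crossing_self, B_sub_left, B_act_left, inv_inv, hn, hθ, hω]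
          ring
        · intro k _ hk
          rw [B_smul_left]
          rcases lt_or_gt_of_ne hk with h | h
          · rw [affineTwist_crossing_of_lt ρ h, margulis_coboundary, mul_zero]
          · rw [affineTwist_crossing_of_gt ρ h, B_zero_left, mul_zero]
      rw [hu]
      simp only [B_add_left, B_sum_left, hsum, margulis]
      ring
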